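/- Let $\mathbf{k}$ be a commutative ring, and let $\Lambda\subseteq\mathbf{k}[[x_1,x_2,x_3,\ldots]]$ be the ring of symmetric functions over $\mathbf{k}$, i.e. the $\mathbf{k}$-algebra of all formal power series that are invariant under all permutations of the variables and of bounded degree. For a finitely supported sequence $\alpha=(\alpha_1,\alpha_2,\ldots)$ of nonnegative integers, write $\mathbf{x}^\alpha=x_1^{\alpha_1}x_2^{\alpha_2}\cdots$ and $|\alpha|=\alpha_1+\alpha_2+\cdots$. For $m\ge 0$ let $h_m=\sum_{|\alpha|=m}\mathbf{x}^\alpha$; for $n\ge 1$ let $p_n=x_1^n+x_2^n+x_3^n+\cdots$; and for $k\ge 1$, $m\ge 0$ let $G(k,m)=\sum_{|\alpha|=m,\ \alpha_i<k\text{ for all }i}\mathbf{x}^\alpha$. Regard $\Lambda$ as a $\mathbf{k}$-Hopf algebra in the usual way: the comultiplication $\Delta:\Lambda\to\Lambda\otimes\Lambda$ is determined by $\Delta(f)=\sum_i u_i\otimes v_i$ whenever $f(x_1,x_2,\ldots,y_1,y_2,\ldots)=\sum_i u_i(x_1,x_2,\ldots)\,v_i(y_1,y_2,\ldots)$ (a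 finite sum with $u_i,v_i\in\Lambda$), and the counit sends each $f$ to its constant coefficient. Let $S$ be the antipode of $\Lambda$. Fix a positive integer $k$. Let $\mathbf{f}_k:\Lambda\to\Lambda$ be the Frobenius endomorphism, $\mathbf{f}_k(a)=a(x_1^k,x_2^k,x_3^k,\ldots)$, and let $\mathbf{v}_k:\Lambda\to\Lambda$ be the Verschiebung endomorphism, i.e. the $\mathbf{k}$-algebra homomorphism with $\mathbf{v}_k(h_m)=h_{m/k}$ if $k\mid m$ and $\mathbf{v}_k(h_m)=0$ if $k\nmid m$, for all $m>0$. Let $U_k=\mathbf{f}_k\circ S\circ\mathbf{v}_k:\Lambda\to\Lambda$, and let $V_k=\mathrm{id}_\Lambda\star U_k=\mu\circ(\mathrm{id}_\Lambda\otimes U_k)\circ\Delta$, where $\mu:\Lambda\otimes\Lambda\to\Lambda$ is the multiplication map. Then: (a) $U_k$ is a $\mathbf{k}$-Hopf algebra homomorphism. (b) $V_k$ is a $\mathbf{k}$-Hopf algebra homomorphism. (c) $V_k(h_m)=G(k,m)$ for each integer $m\ge 0$. (d) $V_k(p_n)=(1-[k\mid n]\,k)\,p_n$ for each positive integer $n$,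 where $[k\mid n]$ is $1$ if $k$ divides $n$ and $0$ otherwise. -/

import Mathlib

open scoped TensorProduct

namespace SymFun

section Defs

/-- A formal power series in `x₀, x₁, x₂, …` is symmetric if it is invariant under all
permutations of the variables. -/
def IsSymm {R : Type*} [CommRing R] (f : MvPowerSeries ℕ R) : Prop :=
  ∀ σ : Equiv.Perm ℕ, MvPowerSeries.renameEquiv R σ f = f

/-- A formal power series is of bounded degree if the degrees of the monomials that appear in it
are bounded. -/
def IsBounded {R : Type*} [CommRing R] (f : MvPowerSeries ℕ R) : Prop :=
  ∃ d : ℕ, ∀ α : ℕ →₀ ℕ, MvPowerSeries.coeff α f ≠ 0 → α.degree ≤ d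

theorem coeff_rename_perm {R : Type*} [CommRing R] (σ : Equiv.Perm ℕ) (f : MvPowerSeries ℕ R)
    (α : ℕ →₀ ℕ) :
    MvPowerSeries.coeff (α.mapDomain σ) (MvPowerSeries.renameEquiv R σ f)
      = MvPowerSeries.coeff α f := by
  have := MvPowerSeries.coeff_embDomain_rename σ.toEmbedding f α
  rw [Finsupp.embDomain_eq_mapDomain] at this
  exact this

theorem isSymm_iff {R : Type*} [CommRing R] (f : MvPowerSeries ℕ R) :
    IsSymm f ↔ ∀ (σ : Equiv.Perm ℕ) (α : ℕ →₀ ℕ),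
      MvPowerSeries.coeff (α.mapDomain σ) f = MvPowerSeries.coeff α f := by
  constructor
  · intro h σ α
    conv_lhs => rw [← h σ]
    exact coeff_rename_perm σ f α
  · intro h σ
    ext β
    have hβ : (β.mapDomain σ.symm).mapDomain σ = β := by
      rw [← Finsupp.mapDomain_comp]; simp
    rw [← hβ, coeff_rename_perm]
    exact (h σ _).symm

/-- The ring `Λ` of symmetric functions over `R`: the subalgebra of `R[[x₀, x₁, x₂, …]]` of all
symmetric power series of bounded degree. (The variable `x_i` of the literature is `x_{i-1}`
here.) -/
def symmAlg (R : Type*) [CommRing R] : Subalgebra R (MvPowerSeries ℕ R) where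
  carrier := {f | IsSymm f ∧ IsBounded f}
  mul_mem' := by
    rintro f g ⟨hf, a, ha⟩ ⟨hg, b, hb⟩
    refine ⟨fun σ => by rw [map_mul, hf, hg], a + b, fun α hα => ?_⟩
    classical
    rw [MvPowerSeries.coeff_mul] at hα
    obtain ⟨p, hp, hne⟩ := Finset.exists_ne_zero_of_sum_ne_zero hα
    rw [← Finset.HasAntidiagonal.mem_antidiagonal.1 hp, map_add]
    exact add_le_add (ha _ (left_ne_zero_of_mul hne)) (hb _ (right_ne_zero_of_mul hne))
  add_mem' := by
    rintro f g ⟨hf, a, ha⟩ ⟨hg, b, hb⟩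
    refine ⟨fun σ => by rw [map_add, hf, hg], max a b, fun α hα => ?_⟩
    by_cases h : MvPowerSeries.coeff α f = 0
    · refine le_max_of_le_right (hb α fun h' => hα ?_)
      rw [map_add, h, h', add_zero]
    · exact le_max_of_le_left (ha α h)
  algebraMap_mem' := by
    intro r
    refine ⟨fun σ => AlgEquiv.commutes _ r, 0, fun α hα => ?_⟩
    classical
    rw [MvPowerSeries.algebraMap_apply, MvPowerSeries.coeff_C] at hα
    have : α = 0 := by by_contra h; simp [h] at hα
    simp [this]

/-- The ring of symmetric functions, as a type. -/
abbrev Lam (R : Type*) [CommRing R] : Type _ := symmAlg R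

open Classical in
/-- The sum of all monomials `x^α`, where `α` ranges over the weak compositions (finitely
supported sequences of natural numbers) that satisfy `P`. -/
noncomputable def monoSum (R : Type*) [CommRing R] (P : (ℕ →₀ ℕ) → Prop) : MvPowerSeries ℕ R :=
  fun α => if P α then 1 else 0

open Classical in
theorem coeff_monoSum {R : Type*} [CommRing R] (P : (ℕ →₀ ℕ) → Prop) (α : ℕ →₀ ℕ) :
    MvPowerSeries.coeff α (monoSum R P) = if P α then 1 else 0 := rfl

theorem degree_perm (σ : Equiv.Perm ℕ) (α : ℕ →₀ ℕ) : (α.mapDomain σ).degree = α.degree := by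
  rw [Finsupp.degree_mapDomain]

theorem mapDomain_perm_apply (σ : Equiv.Perm ℕ) (α : ℕ →₀ ℕ) (i : ℕ) :
    α.mapDomain σ i = α (σ.symm i) := Finsupp.mapDomain_equiv_apply _ _

theorem monoSum_mem {R : Type*} [CommRing R] {P : (ℕ →₀ ℕ) → Prop} (m : ℕ)
    (h1 : ∀ α, P α → α.degree = m)
    (h2 : ∀ (σ : Equiv.Perm ℕ) α, P α → P (α.mapDomain σ)) : monoSum R P ∈ symmAlg R := by
  refine ⟨(isSymm_iff _).2 fun σ α => ?_, m, fun α hα => ?_⟩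
  · rw [coeff_monoSum, coeff_monoSum]
    have h3 : P (α.mapDomain σ) → P α := fun h => by
      have := h2 σ.symm _ h
      rwa [← Finsupp.mapDomain_comp, Equiv.symm_comp_self, Finsupp.mapDomain_id] at this
    have h4 := h2 σ α
    by_cases h : P α <;> simp_all
  · refine (h1 α ?_).le
    by_contra h
    rw [coeff_monoSum, if_neg h] at hα
    exact hα rfl

/-- The complete homogeneous symmetric function `h_m`: the sum of all monomials of degree `m`. -/
noncomputable def h (R : Type*) [CommRing R] (m : ℕ) : Lam R :=
  ⟨monoSum R fun α => α.degree = m,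
    monoSum_mem m (fun _ => id) fun σ α h => by rw [degree_perm, h]⟩

/-- The elementary symmetric function `e_m`: the sum of all squarefree monomials of degree `m`. -/
noncomputable def e (R : Type*) [CommRing R] (m : ℕ) : Lam R :=
  ⟨monoSum R fun α => α.degree = m ∧ ∀ i, α i ≤ 1,
    monoSum_mem m (fun _ h => h.1) fun σ α h =>
      ⟨by rw [degree_perm, h.1], fun i => by rw [mapDomain_perm_apply]; exact h.2 _⟩⟩

/-- The power-sum symmetric function `p_n = x₀ ^ n + x₁ ^ n + x₂ ^ n + ⋯` (for `n ≥ 1`). -/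
noncomputable def p (R : Type*) [CommRing R] (n : ℕ) : Lam R :=
  ⟨monoSum R fun α => ∃ i, α = Finsupp.single i n,
    monoSum_mem n (by rintro _ ⟨i, rfl⟩; simp)
      (by rintro σ _ ⟨i, rfl⟩; exact ⟨σ i, Finsupp.mapDomain_single⟩)⟩

/-- The Petrie symmetric function `G(k, m)`: the sum of all monomials of degree `m` in which every
exponent is smaller than `k`. -/
noncomputable def G (R : Type*) [CommRing R] (k m : ℕ) : Lam R :=
  ⟨monoSum R fun α => α.degree = m ∧ ∀ i, α i < k,
    monoSum_mem m (fun _ h => h.1) fun σ α h =>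
      ⟨by rw [degree_perm, h.1], fun i => by rw [mapDomain_perm_apply]; exact h.2 _⟩⟩

/-- The `n`-th Frobenius endomorphism `f_n` of `Λ`, sending `a` to `a(x₀ ^ n, x₁ ^ n, …)`. -/
noncomputable def frob (R : Type*) [CommRing R] (n : ℕ) (hn : 0 < n) : Lam R →ₐ[R] Lam R :=
  ((MvPowerSeries.expand n hn.ne').comp (symmAlg R).val).codRestrict (symmAlg R) (by
    rintro ⟨f, hf, d, hd⟩
    rw [isSymm_iff] at hf
    have key : ∀ α : ℕ →₀ ℕ, (∃ β : ℕ →₀ ℕ, α = n • β) ∨ ∃ i, ¬ n ∣ α i := fun α => by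
      by_cases h : ∀ i, n ∣ α i
      · refine Or.inl ⟨α.mapRange (· / n) (by simp), ?_⟩
        ext i
        simp [Nat.mul_div_cancel' (h i)]
      · exact Or.inr (not_forall.1 h)
    refine ⟨(isSymm_iff _).2 fun σ α => ?_, n * d, fun α hα => ?_⟩
    · simp only [AlgHom.comp_apply, Subalgebra.coe_val]
      rcases key α with ⟨β, rfl⟩ | ⟨i, hi⟩
      · have : (n • β).mapDomain σ = n • β.mapDomain σ := Finsupp.mapDomain_smul _ _
        rw [this, MvPowerSeries.coeff_expand_smul, MvPowerSeries.coeff_expand_smul, hf]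
      · rw [MvPowerSeries.coeff_expand_of_not_dvd _ _ _ hi,
          MvPowerSeries.coeff_expand_of_not_dvd (i := σ i)]
        rwa [mapDomain_perm_apply, Equiv.symm_apply_apply]
    · simp only [AlgHom.comp_apply, Subalgebra.coe_val] at hα
      rcases key α with ⟨β, rfl⟩ | ⟨i, hi⟩
      · rw [MvPowerSeries.coeff_expand_smul] at hα
        rw [map_nsmul, smul_eq_mul]
        exact Nat.mul_le_mul_left n (hd β hα)
      · exact absurd (MvPowerSeries.coeff_expand_of_not_dvd _ _ _ hi) hα)

end Defs

section Generators

open MvPolynomial (X rename)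

variable {R : Type*} [CommRing R]

theorem coe_h (m : ℕ) : (h R m : MvPowerSeries ℕ R) = monoSum R fun α => α.degree = m := rfl

theorem coe_e (m : ℕ) :
    (e R m : MvPowerSeries ℕ R) = monoSum R fun α => α.degree = m ∧ ∀ i, α i ≤ 1 := rfl

theorem h_zero : h R 0 = 1 := by
  classical
  ext α
  rw [coe_h, coeff_monoSum, Subalgebra.coe_one, MvPowerSeries.coeff_one]
  simp [Finsupp.degree_eq_zero_iff]

theorem e_zero : e R 0 = 1 := by
  classical
  ext α
  rw [coe_e, coeff_monoSum, Subalgebra.coe_one, MvPowerSeries.coeff_one]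
  by_cases hα : α = 0
  · rw [if_pos hα, if_pos (by subst hα; simp)]
  · rw [if_neg hα, if_neg fun h => hα ((Finsupp.degree_eq_zero_iff _).1 h.1)]

theorem sum_single_eq_iff {σ : Type*} (t : Finset σ) (α : σ →₀ ℕ) :
    ∑ i ∈ t, Finsupp.single i 1 = α ↔ α.support = t ∧ ∀ i, α i ≤ 1 := by
  classical
  rw [← Finsupp.indicator_eq_sum_single]
  constructor
  · rintro rfl
    refine ⟨?_, fun i => ?_⟩
    · ext i; simp [Finsupp.indicator_apply]
    · rw [Finsupp.indicator_apply]; split_ifs <;> simp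
  · rintro ⟨rfl, h⟩
    ext i
    have := h i
    rw [Finsupp.indicator_apply]
    split_ifs with hi
    · have := Finsupp.mem_support_iff.1 hi; omega
    · exact (Finsupp.notMem_support_iff.1 hi).symm

theorem degree_eq_card {σ : Type*} (α : σ →₀ ℕ) (h : ∀ i, α i ≤ 1) :
    α.degree = α.support.card := by
  rw [Finsupp.degree_apply, Finset.card_eq_sum_ones]
  refine Finset.sum_congr rfl fun i hi => ?_
  have := Finsupp.mem_support_iff.1 hi
  have := h i
  omega

open Classical in
theorem coeff_esymm (N n : ℕ) (α : Fin N →₀ ℕ) :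
    (MvPolynomial.esymm (Fin N) R n).coeff α
      = if α.degree = n ∧ ∀ i, α i ≤ 1 then 1 else 0 := by
  rw [MvPolynomial.esymm_eq_sum_monomial, MvPolynomial.coeff_sum]
  simp only [MvPolynomial.coeff_monomial, sum_single_eq_iff]
  split_ifs with h
  · rw [Finset.sum_eq_single α.support]
    · simp [h.2]
    · intro t _ ht
      rw [if_neg fun h' => ht h'.1.symm]
    · intro h'
      refine absurd (Finset.mem_powersetCard.2 ⟨Finset.subset_univ _, ?_⟩) h'
      rw [← degree_eq_card α h.2, h.1]
  · refine Finset.sum_eq_zero fun t ht => if_neg fun h' => h ⟨?_, h'.2⟩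
    rw [degree_eq_card α h'.2, h'.1, (Finset.mem_powersetCard.1 ht).2]

/-- Restriction of a symmetric function to the first `N` variables. -/
noncomputable def restr (R : Type*) [CommRing R] (N : ℕ) :
    Lam R →ₐ[R] MvPowerSeries (Fin N) R :=
  (MvPowerSeries.killCompl Fin.valEmbedding).comp (symmAlg R).val

theorem coeff_restr (N : ℕ) (f : Lam R) (α : Fin N →₀ ℕ) :
    MvPowerSeries.coeff α (restr R N f)
      = MvPowerSeries.coeff (α.embDomain Fin.valEmbedding) (f : MvPowerSeries ℕ R) :=
  MvPowerSeries.coeff_killCompl _ _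

theorem restr_e (N n : ℕ) :
    restr R N (e R n) = (MvPolynomial.esymm (Fin N) R n : MvPowerSeries (Fin N) R) := by
  classical
  ext α
  rw [coeff_restr, MvPolynomial.coeff_coe, coeff_esymm, coe_e, coeff_monoSum]
  have key : ((α.embDomain Fin.valEmbedding).degree = n
      ∧ ∀ i, (α.embDomain Fin.valEmbedding) i ≤ 1) ↔ (α.degree = n ∧ ∀ i, α i ≤ 1) := by
    refine and_congr ?_ ⟨fun h i => ?_, fun h i => ?_⟩
    · rw [Finsupp.embDomain_eq_mapDomain, Finsupp.degree_mapDomain]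
    · have := h (Fin.valEmbedding i)
      rwa [Finsupp.embDomain_apply_self] at this
    · by_cases hi : i ∈ Set.range (Fin.valEmbedding : Fin N ↪ ℕ)
      · obtain ⟨j, rfl⟩ := hi
        rw [Finsupp.embDomain_apply_self]
        exact h j
      · rw [Finsupp.embDomain_of_notMem_range _ _ _ hi]; exact Nat.zero_le _
  by_cases hc : α.degree = n ∧ ∀ i, α i ≤ 1
  · rw [if_pos hc, if_pos (key.2 hc)]
  · rw [if_neg hc, if_neg fun h => hc (key.1 h)]

/-- The algebra homomorphism `R[X₀, X₁, …] → Λ` that sends `X_i` to `e_{i+1}`. -/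
noncomputable def eHom (R : Type*) [CommRing R] : MvPolynomial ℕ R →ₐ[R] Lam R :=
  MvPolynomial.aeval fun i => e R (i + 1)

/-- The algebra homomorphism `R[X₀, X₁, …] → Λ` that sends `X_i` to `h_{i+1}`. -/
noncomputable def hHom (R : Type*) [CommRing R] : MvPolynomial ℕ R →ₐ[R] Lam R :=
  MvPolynomial.aeval fun i => h R (i + 1)

theorem restr_eHom (N : ℕ) (Q : MvPolynomial (Fin N) R) :
    restr R N (eHom R (rename Fin.val Q))
      = ((MvPolynomial.esymmAlgHom (Fin N) R N Q).val : MvPowerSeries (Fin N) R) := by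
  have : ((restr R N).comp (eHom R)).comp (rename Fin.val)
      = ((MvPolynomial.coeToMvPowerSeries.algHom (σ := Fin N) (R := R) R).comp
        (Subalgebra.val _)).comp (MvPolynomial.esymmAlgHom (Fin N) R N) := by
    ext i : 1
    simp [eHom, restr_e, MvPolynomial.esymmAlgHom]
  have h2 := DFunLike.congr_fun this Q
  simpa using h2

theorem eHom_injective : Function.Injective (eHom R) := by
  rw [injective_iff_map_eq_zero]
  intro P hP
  obtain ⟨N, hN⟩ : ∃ N, ∀ i ∈ P.vars, i < N :=
    ⟨P.vars.sup id + 1, fun i hi => Nat.lt_succ_of_le (Finset.le_sup (f := id) hi)⟩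
  obtain ⟨Q, rfl⟩ := MvPolynomial.exists_rename_eq_of_vars_subset_range P
    (Fin.val : Fin N → ℕ) Fin.val_injective (fun i hi => ⟨⟨i, hN i hi⟩, rfl⟩)
  have h1 := restr_eHom N Q
  rw [hP, map_zero, eq_comm, MvPolynomial.coe_eq_zero_iff, ZeroMemClass.coe_eq_zero] at h1
  rw [(injective_iff_map_eq_zero _).1 (MvPolynomial.esymmAlgHom_fin_injective R le_rfl) Q h1,
    map_zero]

/-- Homogeneity of power series. -/
def Homog (f : MvPowerSeries ℕ R) (w : ℕ) : Prop :=
  ∀ α, MvPowerSeries.coeff α f ≠ 0 → α.degree = w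

theorem Homog.mul {f g : MvPowerSeries ℕ R} {a b : ℕ} (hf : Homog f a) (hg : Homog g b) :
    Homog (f * g) (a + b) := by
  intro α hα
  classical
  rw [MvPowerSeries.coeff_mul] at hα
  obtain ⟨q, hq, hne⟩ := Finset.exists_ne_zero_of_sum_ne_zero hα
  rw [← Finset.HasAntidiagonal.mem_antidiagonal.1 hq, map_add,
    hf _ (left_ne_zero_of_mul hne), hg _ (right_ne_zero_of_mul hne)]

theorem homog_C (r : R) : Homog (algebraMap R (MvPowerSeries ℕ R) r) 0 := by
  classical
  intro α hα
  rw [MvPowerSeries.algebraMap_apply, MvPowerSeries.coeff_C] at hα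
  have : α = 0 := by by_contra h; simp [h] at hα
  simp [this]

theorem homog_e (n : ℕ) : Homog (e R n : MvPowerSeries ℕ R) n := by
  classical
  intro α hα
  rw [coe_e, coeff_monoSum] at hα
  by_contra h
  exact hα (if_neg fun h' => h h'.1)

theorem homog_monomial (a : ℕ →₀ ℕ) (r : R) :
    ∃ w, Homog (eHom R (MvPolynomial.monomial a r) : MvPowerSeries ℕ R) w := by
  induction a using Finsupp.induction_linear generalizing r with
  | zero =>
    refine ⟨0, ?_⟩
    have : (eHom R (MvPolynomial.monomial 0 r) : MvPowerSeries ℕ R)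
        = algebraMap R (MvPowerSeries ℕ R) r :=
      congrArg Subtype.val ((eHom R).commutes r)
    rw [this]
    exact homog_C r
  | add a b ha hb =>
    obtain ⟨u, hu⟩ := ha r
    obtain ⟨v, hv⟩ := hb 1
    refine ⟨u + v, ?_⟩
    have : MvPolynomial.monomial (a + b) r
      = MvPolynomial.monomial a r * MvPolynomial.monomial b (1 : R) := by
      rw [MvPolynomial.monomial_mul, mul_one]
    rw [this, map_mul]
    exact hu.mul hv
  | single i n =>
    have h1 : ∀ n : ℕ, Homog ((e R (i + 1) ^ n : Lam R) : MvPowerSeries ℕ R) (n * (i + 1)) := by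
      intro n
      induction n with
      | zero => simpa using homog_C (1 : R)
      | succ n ih => rw [pow_succ, add_mul, one_mul]; exact ih.mul (homog_e _)
    refine ⟨0 + n * (i + 1), ?_⟩
    have : eHom R (MvPolynomial.monomial (Finsupp.single i n) r)
        = algebraMap R (Lam R) r * e R (i + 1) ^ n := by
      rw [eHom, MvPolynomial.aeval_monomial, Finsupp.prod_single_index (by simp)]
    rw [this]
    exact (homog_C r).mul (h1 n)

open Classical in
theorem exists_trunc (d : ℕ) (Q : MvPolynomial ℕ R) : ∃ Q' : MvPolynomial ℕ R, ∀ α,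
    MvPowerSeries.coeff α (eHom R Q' : MvPowerSeries ℕ R)
      = if α.degree ≤ d then MvPowerSeries.coeff α (eHom R Q : MvPowerSeries ℕ R) else 0 := by
  induction Q using MvPolynomial.induction_on' with
  | monomial a r =>
    obtain ⟨w, hw⟩ := homog_monomial a r
    by_cases hd : w ≤ d
    · refine ⟨MvPolynomial.monomial a r, fun α => ?_⟩
      split_ifs with h
      · rfl
      · by_contra h'; exact h (hw α h' ▸ hd)
    · refine ⟨0, fun α => ?_⟩
      rw [map_zero, ZeroMemClass.coe_zero, map_zero]
      split_ifs with h
      · by_contra h'; exact hd (hw α (Ne.symm h') ▸ h)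
      · rfl
  | add Q₁ Q₂ h₁ h₂ =>
    obtain ⟨A, hA⟩ := h₁
    obtain ⟨B, hB⟩ := h₂
    refine ⟨A + B, fun α => ?_⟩
    rw [map_add, map_add, Subalgebra.coe_add, Subalgebra.coe_add, map_add, map_add, hA, hB]
    split_ifs <;> simp

theorem eHom_surjective : Function.Surjective (eHom R) := by
  classical
  rintro ⟨f, hf, d, hd⟩
  have hs := (isSymm_iff f).1 hf
  set F : Lam R := ⟨f, hf, d, hd⟩ with hF
  -- the restriction of `f` to `d` variables is a symmetric polynomial
  have hfin : (Function.support fun α : Fin d →₀ ℕ =>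
      MvPowerSeries.coeff α (restr R d F)).Finite := by
    refine (Finsupp.finite_of_degree_le (σ := Fin d) d).subset fun α hα => ?_
    rw [Function.mem_support, coeff_restr] at hα
    have := hd _ hα
    rwa [Finsupp.embDomain_eq_mapDomain, Finsupp.degree_mapDomain] at this
  obtain ⟨g, hg⟩ : ∃ g : MvPolynomial (Fin d) R,
      ∀ α, g.coeff α = MvPowerSeries.coeff α (restr R d F) := by
    refine ⟨∑ α ∈ hfin.toFinset,
      MvPolynomial.monomial α (MvPowerSeries.coeff α (restr R d F)), fun α => ?_⟩
    rw [MvPolynomial.coeff_sum]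
    simp only [MvPolynomial.coeff_monomial]
    rw [Finset.sum_ite_eq' hfin.toFinset α]
    split_ifs with h
    · rfl
    · by_contra h'
      exact h (hfin.mem_toFinset.2 (Ne.symm h'))
  have hgs : g.IsSymmetric := by
    intro τ
    ext β
    obtain ⟨α, rfl⟩ : ∃ α : Fin d →₀ ℕ, β = α.mapDomain τ :=
      ⟨β.mapDomain τ.symm, by rw [← Finsupp.mapDomain_comp]; simp⟩
    rw [MvPolynomial.coeff_rename_mapDomain _ τ.injective, hg, hg, coeff_restr, coeff_restr]
    have : (α.mapDomain τ).embDomain Fin.valEmbedding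
        = (α.embDomain Fin.valEmbedding).mapDomain (τ.viaFintypeEmbedding Fin.valEmbedding) := by
      simp only [Finsupp.embDomain_eq_mapDomain, ← Finsupp.mapDomain_comp]
      congr 1
      ext i
      simp only [Function.comp_apply, Equiv.Perm.viaFintypeEmbedding_apply_image]
    rw [this]
    exact (hs _ _).symm
  obtain ⟨Q, hQ⟩ := MvPolynomial.esymmAlgHom_fin_surjective R (le_refl d) ⟨g, hgs⟩
  have hQ1 := restr_eHom d Q
  rw [hQ] at hQ1
  obtain ⟨Q', hQ'⟩ := exists_trunc d (rename Fin.val Q)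
  refine ⟨Q', Subtype.ext ?_⟩
  ext α
  rw [hQ']
  split_ifs with hα
  · obtain ⟨t, ht, hc⟩ := Finset.exists_subset_card_eq (s := Finset.range d) (n := α.support.card)
      (by
        rw [Finset.card_range]
        refine le_trans ?_ hα
        rw [Finsupp.degree_apply, Finset.card_eq_sum_ones]
        exact Finset.sum_le_sum fun i hi => Nat.one_le_iff_ne_zero.2 (Finsupp.mem_support_iff.1 hi))
    obtain ⟨σ, hσ⟩ := Equiv.Perm.exists_map_finset_eq α.support t hc.symm
    obtain ⟨β, hβ⟩ : ∃ β : Fin d →₀ ℕ, β.embDomain Fin.valEmbedding = α.mapDomain σ := by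
      have : α.mapDomain σ ∈ Set.range (Finsupp.embDomain (M := ℕ) (Fin.valEmbedding (n := d))) := by
        rw [Finsupp.mem_range_embDomain_iff]
        intro i hi
        have hi' : α (σ.symm i) ≠ 0 := by
          rw [← mapDomain_perm_apply]; exact Finsupp.mem_support_iff.1 hi
        have : i ∈ t := by
          rw [← hσ, Finset.mem_map]
          exact ⟨σ.symm i, Finsupp.mem_support_iff.2 hi', by simp⟩
        exact ⟨⟨i, Finset.mem_range.1 (ht this)⟩, rfl⟩
      exact this
    have h1 := (isSymm_iff _).1 (eHom R (rename Fin.val Q)).2.1 σ α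
    rw [← h1, ← hs σ α, ← hβ]
    have h2 := coeff_restr d (eHom R (rename Fin.val Q)) β
    have h3 := coeff_restr d F β
    rw [← h2, hQ1, MvPolynomial.coeff_coe, hg, h3]
  · by_contra h'
    exact hα (hd α (Ne.symm h'))

theorem sum_e_h (n : ℕ) :
    ∑ q ∈ Finset.HasAntidiagonal.antidiagonal n, (-1) ^ q.1 * e R q.1 * h R q.2 = if n = 0 then 1 else 0 := by
  classical
  have hcoeff : ∀ α : ℕ →₀ ℕ, MvPowerSeries.coeff α
      ((∑ q ∈ Finset.HasAntidiagonal.antidiagonal n, (-1) ^ q.1 * e R q.1 * h R q.2 : Lam R) : MvPowerSeries ℕ R)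
      = if α.degree = n then
        ∑ c ∈ Finset.HasAntidiagonal.antidiagonal α with ∀ i, c.1 i ≤ 1, (-1) ^ c.1.degree else 0 := by
    intro α
    have h1 : ∀ q : ℕ × ℕ, MvPowerSeries.coeff α
        (((-1) ^ q.1 * e R q.1 * h R q.2 : Lam R) : MvPowerSeries ℕ R)
        = ∑ c ∈ Finset.HasAntidiagonal.antidiagonal α,
          if (c.1.degree, c.2.degree) = q then
            (if ∀ i, c.1 i ≤ 1 then (-1) ^ c.1.degree else 0) else 0 := by
      intro q
      have : (((-1) ^ q.1 * e R q.1 * h R q.2 : Lam R) : MvPowerSeries ℕ R)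
          = MvPowerSeries.C ((-1) ^ q.1) *
            ((e R q.1 : MvPowerSeries ℕ R) * (h R q.2 : MvPowerSeries ℕ R)) := by
        simp [mul_assoc]
      rw [this, MvPowerSeries.coeff_C_mul, MvPowerSeries.coeff_mul, Finset.mul_sum]
      refine Finset.sum_congr rfl fun c _ => ?_
      rw [coe_e, coe_h, coeff_monoSum, coeff_monoSum]
      by_cases ha : c.1.degree = q.1 <;> by_cases hb : c.2.degree = q.2 <;>
        by_cases hc : ∀ i, c.1 i ≤ 1 <;> simp [Prod.ext_iff, ha, hb, hc]
    rw [AddSubmonoidClass.coe_finsetSum, map_sum, Finset.sum_congr rfl fun q _ => h1 q,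
      Finset.sum_comm]
    have h2 : ∀ c ∈ Finset.HasAntidiagonal.antidiagonal α, (∑ q ∈ Finset.HasAntidiagonal.antidiagonal n,
        if (c.1.degree, c.2.degree) = q then
            (if ∀ i, c.1 i ≤ 1 then (-1 : R) ^ c.1.degree else 0) else 0)
        = if α.degree = n then (if ∀ i, c.1 i ≤ 1 then (-1 : R) ^ c.1.degree else 0) else 0 := by
      intro c hc
      rw [Finset.sum_ite_eq]
      refine if_congr ?_ rfl rfl
      rw [Finset.HasAntidiagonal.mem_antidiagonal,
        ← Finset.HasAntidiagonal.mem_antidiagonal.1 hc, map_add]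
    rw [Finset.sum_congr rfl h2]
    split_ifs with hα
    · rw [Finset.sum_filter]
    · simp
  have hsum : ∀ α : ℕ →₀ ℕ,
      ∑ c ∈ Finset.HasAntidiagonal.antidiagonal α with ∀ i, c.1 i ≤ 1, (-1 : R) ^ c.1.degree
        = if α = 0 then 1 else 0 := by
    intro α
    have h3 : ∑ c ∈ Finset.HasAntidiagonal.antidiagonal α with ∀ i, c.1 i ≤ 1, (-1 : R) ^ c.1.degree
        = ∑ t ∈ α.support.powerset, (-1 : R) ^ t.card := by
      refine Finset.sum_bij' (fun c _ => c.1.support)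
        (fun t _ => (∑ i ∈ t, Finsupp.single i 1, α - ∑ i ∈ t, Finsupp.single i 1))
        ?_ ?_ ?_ ?_ ?_
      · intro c hc
        rw [Finset.mem_filter, Finset.HasAntidiagonal.mem_antidiagonal] at hc
        rw [Finset.mem_powerset, ← hc.1]
        intro i hi
        rw [Finsupp.mem_support_iff] at hi ⊢
        rw [Finsupp.add_apply]
        omega
      · intro t ht
        have h4 := (sum_single_eq_iff t _).1 rfl
        rw [Finset.mem_filter, Finset.HasAntidiagonal.mem_antidiagonal]
        refine ⟨add_tsub_cancel_of_le fun i => ?_, h4.2⟩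
        have h5 := h4.2 i
        dsimp only
        by_cases hi : i ∈ t
        · have := Finsupp.mem_support_iff.1 (Finset.mem_powerset.1 ht hi)
          omega
        · rw [← h4.1, Finsupp.notMem_support_iff] at hi
          omega
      · intro c hc
        rw [Finset.mem_filter, Finset.HasAntidiagonal.mem_antidiagonal] at hc
        have h6 := (sum_single_eq_iff c.1.support c.1).2 ⟨rfl, hc.2⟩
        refine Prod.ext h6 ?_
        simp only [h6]
        rw [← hc.1, add_tsub_cancel_left]
      · intro t _
        exact ((sum_single_eq_iff t _).1 rfl).1
      · intro c hc
        rw [degree_eq_card _ (Finset.mem_filter.1 hc).2]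
    have h7 := congrArg (Int.cast : ℤ → R) (Finset.sum_powerset_neg_one_pow_card (x := α.support))
    push_cast at h7
    rw [h3, h7]
    simp [Finsupp.support_eq_empty]
  apply Subtype.ext
  ext α
  rw [hcoeff, hsum]
  by_cases hn : n = 0
  · subst hn
    rw [if_pos rfl, Subalgebra.coe_one, MvPowerSeries.coeff_one]
    by_cases hα : α = 0
    · simp [hα]
    · simp [hα]
  · rw [if_neg hn, ZeroMemClass.coe_zero, map_zero]
    by_cases hα : α = 0
    · subst hα; simp [Ne.symm hn]
    · simp [hα]

end Generators

section Generators2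

variable {R : Type*} [CommRing R]

theorem exists_omega : ∃ θ : MvPolynomial ℕ R →ₐ[R] MvPolynomial ℕ R,
    hHom R = (eHom R).comp θ ∧ Function.Surjective θ ∧ Function.Injective θ := by
  let E : PowerSeries (MvPolynomial ℕ R) :=
    PowerSeries.mk fun n => if n = 0 then 1 else MvPolynomial.X (n - 1)
  have hE0 : PowerSeries.constantCoeff E = 1 := by
    simp [E, ← PowerSeries.coeff_zero_eq_constantCoeff_apply]
  have hneg : ∀ {A : Type _} [CommRing A] (f : PowerSeries A),
      PowerSeries.evalNegHom (PowerSeries.evalNegHom f) = f := by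
    intro A _ f
    ext n
    simp [PowerSeries.evalNegHom, PowerSeries.coeff_rescale, ← mul_assoc, ← mul_pow]
  have hnegmap : ∀ {A B : Type _} [CommRing A] [CommRing B] (g : A →+* B) (f : PowerSeries A),
      PowerSeries.evalNegHom (PowerSeries.map g f)
        = PowerSeries.map g (PowerSeries.evalNegHom f) := by
    intro A B _ _ g f
    ext n
    simp [PowerSeries.evalNegHom, PowerSeries.coeff_rescale]
  have hcn : PowerSeries.constantCoeff (PowerSeries.evalNegHom E) = ((1 : (MvPolynomial ℕ R)ˣ) : MvPolynomial ℕ R) := by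
    rw [← PowerSeries.coeff_zero_eq_constantCoeff_apply]
    simp [PowerSeries.evalNegHom, PowerSeries.coeff_rescale, hE0]
  let H := PowerSeries.invOfUnit (PowerSeries.evalNegHom E) 1
  have hEH : PowerSeries.evalNegHom E * H = 1 := PowerSeries.mul_invOfUnit _ 1 hcn
  have hH0 : PowerSeries.coeff 0 H = 1 := by
    simp [H, PowerSeries.coeff_invOfUnit]
  let θ : MvPolynomial ℕ R →ₐ[R] MvPolynomial ℕ R :=
    MvPolynomial.aeval fun i => PowerSeries.coeff (i + 1) H
  have hθE : PowerSeries.map (θ : MvPolynomial ℕ R →+* MvPolynomial ℕ R) E = H := by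
    ext1 n
    rw [PowerSeries.coeff_map, PowerSeries.coeff_mk]
    rcases n with _ | n
    · simp [hH0]
    · simp [θ]
  have hθH : PowerSeries.map (θ : MvPolynomial ℕ R →+* MvPolynomial ℕ R) H = E := by
    have h1 := congrArg (PowerSeries.map (θ : MvPolynomial ℕ R →+* MvPolynomial ℕ R)) hEH
    rw [map_mul, ← hnegmap, hθE, map_one] at h1
    have h2 := congrArg PowerSeries.evalNegHom hEH
    rw [map_mul, hneg, map_one] at h2
    calc _ = (E * PowerSeries.evalNegHom H) * PowerSeries.map (θ : MvPolynomial ℕ R →+* MvPolynomial ℕ R) H := by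
          rw [h2, one_mul]
      _ = E := by rw [mul_assoc, h1, mul_one]
  have hθθ : ∀ P, θ (θ P) = P := by
    have : θ.comp θ = AlgHom.id R _ := by
      ext1 i
      have h1 := congrArg (PowerSeries.coeff (i + 1)) hθH
      rw [PowerSeries.coeff_map, PowerSeries.coeff_mk] at h1
      have h2 : θ (MvPolynomial.X i) = PowerSeries.coeff (i + 1) H := by simp [θ]
      rw [AlgHom.comp_apply, h2]
      simpa using h1
    exact fun P => DFunLike.congr_fun this P
  refine ⟨θ, ?_, fun P => ⟨θ P, hθθ P⟩, fun P Q hPQ => ?_⟩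
  · have heE : PowerSeries.map (eHom R : MvPolynomial ℕ R →+* Lam R) E
        = PowerSeries.mk fun n => e R n := by
      ext1 n
      rw [PowerSeries.coeff_map, PowerSeries.coeff_mk, PowerSeries.coeff_mk]
      rcases n with _ | n
      · simp [e_zero]
      · simp [eHom]
    have hrel : PowerSeries.evalNegHom (PowerSeries.mk fun n => e R n)
        * PowerSeries.mk (fun n => h R n) = 1 := by
      ext1 n
      rw [PowerSeries.coeff_mul, PowerSeries.coeff_one, ← sum_e_h]
      refine Finset.sum_congr rfl fun q _ => ?_
      simp [PowerSeries.evalNegHom, PowerSeries.coeff_rescale]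
    have h1 := congrArg (PowerSeries.map (eHom R : MvPolynomial ℕ R →+* Lam R)) hEH
    rw [map_mul, ← hnegmap, heE, map_one] at h1
    have h2 : PowerSeries.map (eHom R : MvPolynomial ℕ R →+* Lam R) H
        = PowerSeries.mk fun n => h R n := by
      rw [mul_comm] at hrel
      calc _ = (PowerSeries.mk (fun n => h R n)
            * PowerSeries.evalNegHom (PowerSeries.mk fun n => e R n))
            * PowerSeries.map (eHom R : MvPolynomial ℕ R →+* Lam R) H := by rw [hrel, one_mul]
        _ = _ := by rw [mul_assoc, h1, mul_one]
    ext1 i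
    have h3 := congrArg (PowerSeries.coeff (i + 1)) h2
    rw [PowerSeries.coeff_map, PowerSeries.coeff_mk] at h3
    simpa [hHom, θ] using h3.symm
  · rw [← hθθ P, hPQ, hθθ Q]

theorem hHom_bijective : Function.Bijective (hHom R) := by
  obtain ⟨θ, h1, h2, h3⟩ := exists_omega (R := R)
  rw [h1]
  exact ⟨eHom_injective.comp h3, eHom_surjective.comp h2⟩

variable (R) in
/-- `Λ` is freely generated by `h_1, h_2, h_3, …` as a commutative algebra: the isomorphism
`R[X₀, X₁, …] ≃ Λ` that sends `X_i` to `h_{i+1}`. -/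
noncomputable def hEquiv : MvPolynomial ℕ R ≃ₐ[R] Lam R :=
  AlgEquiv.ofBijective (hHom R) hHom_bijective

theorem hEquiv_X (i : ℕ) : hEquiv R (MvPolynomial.X i) = h R (i + 1) := by
  simp [hEquiv, hHom]

/-- The algebra homomorphism out of `Λ` with prescribed images of `h_1, h_2, h_3, …`
(the value `a 0` is not used). -/
noncomputable def liftH {A : Type*} [CommRing A] [Algebra R A] (a : ℕ → A) : Lam R →ₐ[R] A :=
  (MvPolynomial.aeval fun i => a (i + 1)).comp (hEquiv R).symm.toAlgHom

theorem liftH_h {A : Type*} [CommRing A] [Algebra R A] (a : ℕ → A) {m : ℕ} (hm : 0 < m) :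
    liftH (R := R) a (h R m) = a m := by
  obtain ⟨i, rfl⟩ := Nat.exists_eq_succ_of_ne_zero hm.ne'
  rw [Nat.succ_eq_add_one, ← hEquiv_X]
  simp [liftH]

/-- Algebra homomorphisms out of `Λ` are determined by their values on `h_1, h_2, h_3, …`. -/
theorem algHom_ext_h {A : Type*} [CommRing A] [Algebra R A] {f g : Lam R →ₐ[R] A}
    (hfg : ∀ m, 0 < m → f (h R m) = g (h R m)) : f = g := by
  have : f.comp (hEquiv R).toAlgHom = g.comp (hEquiv R).toAlgHom := by
    ext1 i
    simpa [hEquiv_X] using hfg (i + 1) (Nat.succ_pos i)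
  ext1 x
  have h1 := DFunLike.congr_fun this ((hEquiv R).symm x)
  simpa using h1

end Generators2

section Coproduct

variable {R : Type*} [CommRing R]

open MvPowerSeries (rename)

variable (R) in
/-- The canonical map `Λ ⊗ Λ → R[[x, y]]` that sends `u ⊗ v` to `u(x) v(y)`. The variables
`x₀, x₁, …` and `y₀, y₁, …` are indexed by the two summands of `ℕ ⊕ ℕ`. -/
noncomputable def tensorEmb : Lam R ⊗[R] Lam R →ₐ[R] MvPowerSeries (ℕ ⊕ ℕ) R :=
  Algebra.TensorProduct.productMap
    ((rename (Function.Embedding.inl : ℕ ↪ ℕ ⊕ ℕ)).comp (symmAlg R).val)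
    ((rename (Function.Embedding.inr : ℕ ↪ ℕ ⊕ ℕ)).comp (symmAlg R).val)

variable (R) in
/-- The map `f ↦ f(x, y)`, substituting all of the variables `x₀, x₁, …, y₀, y₁, …` for the
variables `x₀, x₁, …`, by means of a bijection between the two sets of variables. -/
noncomputable def doubleVars : Lam R →ₐ[R] MvPowerSeries (ℕ ⊕ ℕ) R :=
  (MvPowerSeries.renameEquiv R Equiv.natSumNatEquivNat.symm).toAlgHom.comp (symmAlg R).val

/-- The series `f(x, y)` does not depend on the choice of the bijection. -/
theorem doubleVars_eq (φ : ℕ ≃ ℕ ⊕ ℕ) (f : Lam R) :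
    doubleVars R f = MvPowerSeries.renameEquiv R φ f := by
  have h1 := f.2.1 (φ.trans Equiv.natSumNatEquivNat)
  rw [← MvPowerSeries.renameEquiv_trans] at h1
  have h2 : doubleVars R f
      = MvPowerSeries.renameEquiv R Equiv.natSumNatEquivNat.symm (f : MvPowerSeries ℕ R) := rfl
  rw [h2]
  conv_lhs => rw [← h1]
  rw [← MvPowerSeries.renameEquiv_symm]
  simp only [AlgEquiv.trans_apply, AlgEquiv.symm_apply_apply]

/-- The exponent vector on `ℕ ⊕ ℕ` with given parts. -/
noncomputable def pair (α β : ℕ →₀ ℕ) : ℕ ⊕ ℕ →₀ ℕ :=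
  α.embDomain Function.Embedding.inl + β.embDomain Function.Embedding.inr

theorem pair_inl (α β : ℕ →₀ ℕ) (i : ℕ) : pair α β (Sum.inl i) = α i := by
  have h1 := Finsupp.embDomain_apply_self Function.Embedding.inl α i (β := ℕ ⊕ ℕ)
  have h2 := Finsupp.embDomain_of_notMem_range Function.Embedding.inr β (Sum.inl i : ℕ ⊕ ℕ)
    (by simp)
  rw [pair, Finsupp.add_apply, h2, add_zero]
  exact h1

theorem pair_inr (α β : ℕ →₀ ℕ) (i : ℕ) : pair α β (Sum.inr i) = β i := by
  have h1 := Finsupp.embDomain_apply_self Function.Embedding.inr β i (β := ℕ ⊕ ℕ)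
  have h2 := Finsupp.embDomain_of_notMem_range Function.Embedding.inl α (Sum.inr i : ℕ ⊕ ℕ)
    (by simp)
  rw [pair, Finsupp.add_apply, h2, zero_add]
  exact h1

theorem exists_pair (γ : ℕ ⊕ ℕ →₀ ℕ) : ∃ α β, γ = pair α β := by
  refine ⟨γ.comapDomain Sum.inl Sum.inl_injective.injOn,
    γ.comapDomain Sum.inr Sum.inr_injective.injOn, ?_⟩
  ext (i | i)
  · rw [pair_inl]; rfl
  · rw [pair_inr]; rfl

theorem pair_inj {α β α' β' : ℕ →₀ ℕ} (h : pair α β = pair α' β') : α = α' ∧ β = β' := by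
  constructor
  · ext i; rw [← pair_inl α β, h, pair_inl]
  · ext i; rw [← pair_inr α β, h, pair_inr]

theorem coeff_mul_rename (f g : MvPowerSeries ℕ R) (α β : ℕ →₀ ℕ) :
    MvPowerSeries.coeff (pair α β) (rename (Function.Embedding.inl : ℕ ↪ ℕ ⊕ ℕ) f
        * rename (Function.Embedding.inr : ℕ ↪ ℕ ⊕ ℕ) g)
      = MvPowerSeries.coeff α f * MvPowerSeries.coeff β g := by
  classical
  rw [MvPowerSeries.coeff_mul, Finset.sum_eq_single
    (α.embDomain Function.Embedding.inl, β.embDomain Function.Embedding.inr)]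
  · rw [MvPowerSeries.coeff_embDomain_rename, MvPowerSeries.coeff_embDomain_rename]
  · rintro ⟨u, v⟩ huv hne
    by_contra hc
    have hu : u ∈ Set.range (Finsupp.mapDomain (Function.Embedding.inl : ℕ ↪ ℕ ⊕ ℕ)) := by
      by_contra h; exact hc (by rw [MvPowerSeries.coeff_rename_eq_zero _ _ h, zero_mul])
    have hv : v ∈ Set.range (Finsupp.mapDomain (Function.Embedding.inr : ℕ ↪ ℕ ⊕ ℕ)) := by
      by_contra h; exact hc (by rw [MvPowerSeries.coeff_rename_eq_zero _ _ h, mul_zero])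
    obtain ⟨a, rfl⟩ := hu
    obtain ⟨b, rfl⟩ := hv
    rw [Finset.HasAntidiagonal.mem_antidiagonal] at huv
    rw [← Finsupp.embDomain_eq_mapDomain, ← Finsupp.embDomain_eq_mapDomain] at huv hne
    change pair a b = pair α β at huv
    obtain ⟨rfl, rfl⟩ := pair_inj huv
    exact hne rfl
  · intro h
    refine absurd (Finset.HasAntidiagonal.mem_antidiagonal.2 ?_) h
    rw [pair]

theorem tensorEmb_tmul (u v : Lam R) : tensorEmb R (u ⊗ₜ v)
    = rename (Function.Embedding.inl : ℕ ↪ ℕ ⊕ ℕ) u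
      * rename (Function.Embedding.inr : ℕ ↪ ℕ ⊕ ℕ) v := rfl

theorem tensorEmb_injective : Function.Injective (tensorEmb R) := by
  let b := (MvPolynomial.basisMonomials ℕ R).map (hEquiv R).toLinearEquiv
  rw [injective_iff_map_eq_zero]
  intro t ht
  obtain ⟨c, rfl⟩ := (TensorProduct.equivFinsuppOfBasisRight (M := Lam R) b).symm.surjective t
  suffices c = 0 by rw [this, map_zero]
  rw [TensorProduct.equivFinsuppOfBasisRight_symm_apply] at ht
  have hco : ∀ α β : ℕ →₀ ℕ, ∑ j ∈ c.support,
      MvPowerSeries.coeff α (c j : MvPowerSeries ℕ R)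
        * MvPowerSeries.coeff β (b j : MvPowerSeries ℕ R) = 0 := by
    intro α β
    have h1 := congrArg (MvPowerSeries.coeff (pair α β)) ht
    rw [Finsupp.sum, map_sum, map_sum, map_zero] at h1
    rw [← h1]
    refine Finset.sum_congr rfl fun j _ => ?_
    rw [tensorEmb_tmul, coeff_mul_rename]
  have hli : ∀ α : ℕ →₀ ℕ, ∑ j ∈ c.support,
      MvPowerSeries.coeff α (c j : MvPowerSeries ℕ R) • b j = 0 := by
    intro α
    apply Subtype.ext
    ext β
    rw [AddSubmonoidClass.coe_finsetSum, map_sum, ZeroMemClass.coe_zero, map_zero, ← hco α β]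
    refine Finset.sum_congr rfl fun j _ => ?_
    rw [Subalgebra.coe_smul, map_smul, smul_eq_mul]
  ext1 j
  by_contra hj
  refine hj (Subtype.ext ?_)
  ext α
  simpa using linearIndependent_iff'.1 b.linearIndependent c.support _ (hli α) j
    (Finsupp.mem_support_iff.2 hj)

theorem tensorEmb_h (m : ℕ) :
    tensorEmb R (∑ q ∈ Finset.HasAntidiagonal.antidiagonal m, h R q.1 ⊗ₜ h R q.2)
      = doubleVars R (h R m) := by
  classical
  ext γ
  obtain ⟨α, β, rfl⟩ := exists_pair γ
  let φ : ℕ ≃ ℕ ⊕ ℕ := Equiv.natSumNatEquivNat.symm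
  obtain ⟨δ, hδ⟩ : ∃ δ : ℕ →₀ ℕ, pair α β = δ.embDomain φ.toEmbedding :=
    ⟨(pair α β).mapDomain φ.symm, by
      rw [Finsupp.embDomain_eq_mapDomain, ← Finsupp.mapDomain_comp]; simp⟩
  have hdeg : δ.degree = α.degree + β.degree := by
    have h1 := congrArg Finsupp.degree hδ
    rw [Finsupp.embDomain_eq_mapDomain, Finsupp.degree_mapDomain, pair, map_add,
      Finsupp.embDomain_eq_mapDomain, Finsupp.embDomain_eq_mapDomain, Finsupp.degree_mapDomain,
      Finsupp.degree_mapDomain] at h1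
    exact h1.symm
  have hR : MvPowerSeries.coeff (pair α β) (doubleVars R (h R m))
      = MvPowerSeries.coeff δ (h R m : MvPowerSeries ℕ R) := by
    rw [hδ]
    exact MvPowerSeries.coeff_embDomain_rename φ.toEmbedding _ δ
  have h2 : ∀ q : ℕ × ℕ, MvPowerSeries.coeff (pair α β) (tensorEmb R (h R q.1 ⊗ₜ h R q.2))
      = if (α.degree, β.degree) = q then 1 else 0 := by
    intro q
    rw [tensorEmb_tmul, coeff_mul_rename, coe_h, coe_h, coeff_monoSum, coeff_monoSum]
    by_cases ha : α.degree = q.1 <;> by_cases hb : β.degree = q.2 <;>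
      simp [Prod.ext_iff, ha, hb]
  rw [hR, coe_h, coeff_monoSum, map_sum, map_sum, Finset.sum_congr rfl fun q _ => h2 q,
    Finset.sum_ite_eq, hdeg]
  simp

theorem doubleVars_mem (f : Lam R) : doubleVars R f ∈ (tensorEmb R).range := by
  have h1 : ((tensorEmb R).range.val.comp (liftH (R := R) fun m =>
      (⟨tensorEmb R (∑ q ∈ Finset.HasAntidiagonal.antidiagonal m, h R q.1 ⊗ₜ h R q.2), _, rfl⟩ :
        (tensorEmb R).range))) = doubleVars R := by
    refine algHom_ext_h fun m hm => ?_
    rw [AlgHom.comp_apply, liftH_h _ hm]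
    exact tensorEmb_h m
  rw [← h1]
  exact Subtype.property _

variable (R) in
/-- The comultiplication of `Λ`: the element `Δ f` of `Λ ⊗ Λ` is the (unique) preimage of
`f(x, y)` under the canonical injection `Λ ⊗ Λ → R[[x, y]]`, `u ⊗ v ↦ u(x) v(y)`. -/
noncomputable def comulHom : Lam R →ₐ[R] Lam R ⊗[R] Lam R :=
  (AlgEquiv.ofInjective (tensorEmb R) tensorEmb_injective).symm.toAlgHom.comp
    ((doubleVars R).codRestrict _ doubleVars_mem)

/-- The defining property of the comultiplication. -/
theorem tensorEmb_comulHom (f : Lam R) : tensorEmb R (comulHom R f) = doubleVars R f := by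
  have h1 := AlgEquiv.apply_symm_apply (AlgEquiv.ofInjective (tensorEmb R) tensorEmb_injective)
    ((doubleVars R).codRestrict _ doubleVars_mem f)
  exact congrArg Subtype.val h1

theorem comulHom_h (m : ℕ) : comulHom R (h R m)
    = ∑ q ∈ Finset.HasAntidiagonal.antidiagonal m, h R q.1 ⊗ₜ h R q.2 := by
  apply tensorEmb_injective
  rw [tensorEmb_comulHom, tensorEmb_h]

variable (R) in
/-- The counit of `Λ`: the constant coefficient. -/
noncomputable def counitHom : Lam R →ₐ[R] R :=
  { (MvPowerSeries.constantCoeff (σ := ℕ) (R := R)).comp (symmAlg R).val.toRingHom with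
    commutes' := fun r => by
      simp [MvPowerSeries.algebraMap_apply] }

theorem counitHom_h (m : ℕ) : counitHom R (h R m) = if m = 0 then 1 else 0 := by
  have h1 : counitHom R (h R m) = MvPowerSeries.coeff 0 (h R m : MvPowerSeries ℕ R) := rfl
  rw [h1, coe_h, coeff_monoSum]
  by_cases hm : m = 0
  · simp [hm]
  · simp [hm, Ne.symm hm]

variable (R) in
/-- The antipode of `Λ`, as an algebra homomorphism (the antipode of a bialgebra is unique). -/
noncomputable def antipodeHom : Lam R →ₐ[R] Lam R := liftH fun m => (-1) ^ m * e R m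

theorem antipodeHom_h (m : ℕ) : antipodeHom R (h R m) = (-1) ^ m * e R m := by
  rcases Nat.eq_zero_or_pos m with rfl | hm
  · rw [h_zero, e_zero, map_one]; simp
  · exact liftH_h _ hm

noncomputable instance instBialgebra : Bialgebra R (Lam R) :=
  Bialgebra.ofAlgHom (comulHom R) (counitHom R)
    (by
      refine algHom_ext_h (A := Lam R ⊗[R] (Lam R ⊗[R] Lam R)) fun m _ => ?_
      simp only [AlgHom.comp_apply, comulHom_h, map_sum, Algebra.TensorProduct.map_tmul,
        AlgHom.id_apply, TensorProduct.sum_tmul, TensorProduct.tmul_sum]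
      rw [Finset.sum_sigma', Finset.sum_sigma']
      refine Finset.sum_bij'
        (fun x _ => ⟨(x.2.1, x.2.2 + x.1.2), (x.2.2, x.1.2)⟩)
        (fun x _ => ⟨(x.1.1 + x.2.1, x.2.2), (x.1.1, x.2.1)⟩) ?_ ?_ ?_ ?_ ?_
      · rintro ⟨⟨a, b⟩, ⟨c, d⟩⟩ hx
        simp only [Finset.mem_sigma, Finset.HasAntidiagonal.mem_antidiagonal] at hx ⊢
        exact ⟨by omega, trivial⟩
      · rintro ⟨⟨a, b⟩, ⟨c, d⟩⟩ hx
        simp only [Finset.mem_sigma, Finset.HasAntidiagonal.mem_antidiagonal] at hx ⊢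
        exact ⟨by omega, trivial⟩
      · rintro ⟨⟨a, b⟩, ⟨c, d⟩⟩ hx
        simp only [Finset.mem_sigma, Finset.HasAntidiagonal.mem_antidiagonal] at hx
        obtain ⟨-, rfl⟩ := hx
        rfl
      · rintro ⟨⟨a, b⟩, ⟨c, d⟩⟩ hx
        simp only [Finset.mem_sigma, Finset.HasAntidiagonal.mem_antidiagonal] at hx
        obtain ⟨-, rfl⟩ := hx
        rfl
      · rintro ⟨⟨a, b⟩, ⟨c, d⟩⟩ hx
        rfl)
    (by
      refine algHom_ext_h fun m _ => ?_
      simp only [AlgHom.comp_apply, comulHom_h, map_sum, Algebra.TensorProduct.map_tmul,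
        AlgHom.id_apply, counitHom_h]
      rw [Finset.sum_eq_single (0, m)]
      · simp
      · rintro ⟨a, b⟩ hab hne
        rw [Finset.HasAntidiagonal.mem_antidiagonal] at hab
        have : a ≠ 0 := by rintro rfl; simp at hab; exact hne (by simp [hab])
        simp [this]
      · intro h; simp at h)
    (by
      refine algHom_ext_h (A := Lam R ⊗[R] R) fun m _ => ?_
      simp only [AlgHom.comp_apply, comulHom_h, map_sum, Algebra.TensorProduct.map_tmul,
        AlgHom.id_apply, counitHom_h]
      rw [Finset.sum_eq_single (m, 0)]
      · simp
      · rintro ⟨a, b⟩ hab hne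
        rw [Finset.HasAntidiagonal.mem_antidiagonal] at hab
        have : b ≠ 0 := by rintro rfl; simp at hab; exact hne (by simp [hab])
        simp [this]
      · intro h; simp at h)

theorem counitHom_eq_sum (m : ℕ) : algebraMap R (Lam R) (counitHom R (h R m))
    = ∑ q ∈ Finset.HasAntidiagonal.antidiagonal m, (-1) ^ q.1 * e R q.1 * h R q.2 := by
  rw [sum_e_h, counitHom_h]
  split_ifs <;> simp

noncomputable instance instHopfAlgebra : HopfAlgebra R (Lam R) :=
  HopfAlgebra.ofAlgHom (antipodeHom R)
    (by
      refine algHom_ext_h fun m _ => ?_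
      have h1 : Bialgebra.comulAlgHom R (Lam R) (h R m) = comulHom R (h R m) := rfl
      have h2 : Bialgebra.counitAlgHom R (Lam R) (h R m) = counitHom R (h R m) := rfl
      rw [AlgHom.comp_apply, AlgHom.comp_apply, h1, h2, comulHom_h, map_sum]
      refine Eq.trans ?_ (counitHom_eq_sum m).symm
      refine Finset.sum_congr rfl fun q _ => ?_
      rw [← antipodeHom_h]
      exact Algebra.TensorProduct.lift_tmul _ _ _ _ _)
    (by
      refine algHom_ext_h fun m _ => ?_
      have h1 : Bialgebra.comulAlgHom R (Lam R) (h R m) = comulHom R (h R m) := rfl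
      have h2 : Bialgebra.counitAlgHom R (Lam R) (h R m) = counitHom R (h R m) := rfl
      rw [AlgHom.comp_apply, AlgHom.comp_apply, h1, h2, comulHom_h, map_sum]
      refine Eq.trans ?_ (counitHom_eq_sum m).symm
      rw [← Finset.Nat.sum_antidiagonal_swap]
      refine Finset.sum_congr rfl fun q _ => ?_
      rw [← antipodeHom_h, mul_comm]
      exact Algebra.TensorProduct.lift_tmul _ _ _ _ _)

end Coproduct

section Main

/-- The `n`-th Verschiebung endomorphism `v_n` of `Λ`: the algebra homomorphism that sends `h_m`
(for `m > 0`) to `h_{m/n}` if `n ∣ m` and to `0` otherwise. -/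
noncomputable def versch (R : Type*) [CommRing R] (n : ℕ) : Lam R →ₐ[R] Lam R :=
  liftH fun m => if n ∣ m then h R (m / n) else 0

/-- A linear endomorphism of a Hopf algebra is a Hopf algebra homomorphism if it is a homomorphism
of algebras and of coalgebras and commutes with the antipode. -/
def IsHopfHom {R A : Type*} [CommRing R] [Ring A] [HopfAlgebra R A] (f : A →ₗ[R] A) : Prop :=
  (∃ F : A →ₐc[R] A, ∀ a, F a = f a) ∧
    ∀ a, f (HopfAlgebra.antipode R a) = HopfAlgebra.antipode R (f a)

/-- The map `U_k = f_k ∘ S ∘ v_k`, with `S` the antipode of `Λ`. -/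
noncomputable def U (R : Type*) [CommRing R] (k : ℕ) (hk : 0 < k) : Lam R →ₗ[R] Lam R :=
  (frob R k hk).toLinearMap ∘ₗ HopfAlgebra.antipode R ∘ₗ (versch R k).toLinearMap

/-- The map `V_k = id ⋆ U_k`, where `⋆` is the convolution of linear maps. -/
noncomputable def V (R : Type*) [CommRing R] (k : ℕ) (hk : 0 < k) : Lam R →ₗ[R] Lam R :=
  (WithConv.toConv LinearMap.id * WithConv.toConv (U R k hk)).ofConv

end Main
end SymFun

/-! The Hopf part is formal. The maps `f_k`, `S` and `v_k` are bialgebra endomorphisms of `Λ`: for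
`S` and `v_k` this is checked on the generators `h_m` (`antipodeBialgHom`, `verschBialgHom`), and
for `f_k` on power series, where raising all variables to the `k`-th power is compatible with
splitting them into two families (`frobBialgHom`). So `U_k` is a bialgebra homomorphism. Since `Λ`
is commutative and cocommutative, the convolution `V_k = id ⋆ U_k` of two bialgebra homomorphisms is
one as well. Compatibility with the antipode is then automatic (`BialgHom.apply_antipode`).

For the values on `h_m`, use generating functions: the `h_m` add up to `∏ 1/(1 - x_i)`, and the
`U_k(h_m)` to `∏ (1 - x_i^k)` (`coeff_U_h`). As `Δ(h_m) = ∑ h_i ⊗ h_{m-i}`, the `V_k(h_m)` add up to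
`∏ (1 + x_i + ⋯ + x_i^{k-1})`, the sum of the `G(k, m)`. On coefficients this is an alternating sum
over subsets (`sum_blockSign`).

For the values on `p_n`: `p_n` is primitive (`comulHom_p`), so `V_k(p_n) = p_n + U_k(p_n)`. If `k ∣
n`, then `v_k(p_n) = k p_{n/k}` by Newton's identity (`versch_pPos`), `S` changes the sign, and
`f_k` turns `p_{n/k}` back into `p_n`; otherwise `v_k(p_n) = 0`. -/

/-- Both `F ∘ S` and `S ∘ F` are left inverses of `F` for the convolution of algebra homomorphisms
`A → B`: composing `S ⋆ id = 1` with `F` on either side gives the two identities. Cancelling `F`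
identifies them. -/
theorem BialgHom.apply_antipode {R A B : Type*} [CommRing R] [CommRing A] [CommRing B]
    [HopfAlgebra R A] [HopfAlgebra R B] (F : A →ₐc[R] B) (a : A) :
    F (HopfAlgebra.antipode R a) = HopfAlgebra.antipode R (F a) := by
  have h1 : WithConv.toConv ((F : A →ₐ[R] B).comp (HopfAlgebra.antipodeAlgHom R A))
      * WithConv.toConv (F : A →ₐ[R] B) = 1 := by
    have := AlgHom.comp_convMul_distrib (F : A →ₐ[R] B)
      (WithConv.toConv (HopfAlgebra.antipodeAlgHom R A)) (WithConv.toConv (AlgHom.id R A))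
    rw [AlgHom.antipode_id_cancel] at this
    apply WithConv.ofConv_injective
    refine Eq.trans this.symm ?_
    ext x
    exact (F : A →ₐ[R] B).commutes _
  have h2 : WithConv.toConv ((HopfAlgebra.antipodeAlgHom R B).comp (F : A →ₐ[R] B))
      * WithConv.toConv (F : A →ₐ[R] B) = 1 := by
    have := AlgHom.convMul_comp_bialgHom_distrib
      (WithConv.toConv (HopfAlgebra.antipodeAlgHom R B)) (WithConv.toConv (AlgHom.id R B)) F
    rw [AlgHom.antipode_id_cancel] at this
    apply WithConv.ofConv_injective
    refine Eq.trans this.symm ?_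
    ext x
    exact congrArg (algebraMap R B) (CoalgHomClass.counit_comp_apply F x)
  have h3 := congrArg WithConv.ofConv (mul_right_cancel (h1.trans h2.symm))
  exact DFunLike.congr_fun h3 a

namespace SymFun

/-! ### Frobenius, antipode and Verschiebung as bialgebra endomorphisms -/

section HopfMaps

variable {R : Type*} [CommRing R]

open MvPowerSeries (coeff)

theorem degree_embDomain {σ τ : Type*} (f : σ ↪ τ) (α : σ →₀ ℕ) :
    (α.embDomain f).degree = α.degree := by
  rw [Finsupp.embDomain_eq_mapDomain, Finsupp.degree_mapDomain]

theorem degree_pair (α β : ℕ →₀ ℕ) : (pair α β).degree = α.degree + β.degree := by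
  rw [pair, map_add, degree_embDomain, degree_embDomain]

/-- The coefficients of `f(x, y)` in terms of those of `f`. -/
theorem exists_coeff_doubleVars (γ : ℕ ⊕ ℕ →₀ ℕ) : ∃ δ : ℕ →₀ ℕ,
    γ = δ.embDomain Equiv.natSumNatEquivNat.symm.toEmbedding ∧
    ∀ f : Lam R, coeff γ (doubleVars R f) = coeff δ (f : MvPowerSeries ℕ R) := by
  obtain ⟨δ, rfl⟩ : ∃ δ : ℕ →₀ ℕ, γ = δ.embDomain Equiv.natSumNatEquivNat.symm.toEmbedding :=
    ⟨γ.mapDomain Equiv.natSumNatEquivNat, by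
      rw [Finsupp.embDomain_eq_mapDomain, ← Finsupp.mapDomain_comp, Equiv.coe_toEmbedding,
        Equiv.symm_comp_self, Finsupp.mapDomain_id]⟩
  exact ⟨δ, rfl, fun f => MvPowerSeries.coeff_embDomain_rename _ _ δ⟩

theorem forall_embDomain_equiv {σ τ : Type*} (φ : σ ≃ τ) (δ : σ →₀ ℕ) (P : ℕ → Prop) :
    (∀ i, P (δ.embDomain φ.toEmbedding i)) ↔ ∀ i, P (δ i) := by
  rw [← φ.forall_congr_right]
  refine forall_congr' fun i => ?_
  rw [← Equiv.coe_toEmbedding, Finsupp.embDomain_apply_self]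

/-- A monomial in `x` and `y` is squarefree exactly when its `x`-part and its `y`-part are, and the
degrees of the two parts single out one summand. This serves to compute the coproduct of `S(h_m) = ±
e_m`. -/
theorem tensorEmb_e (m : ℕ) :
    tensorEmb R (∑ q ∈ Finset.HasAntidiagonal.antidiagonal m, e R q.1 ⊗ₜ e R q.2)
      = doubleVars R (e R m) := by
  classical
  ext γ
  obtain ⟨δ, hδ, hc⟩ := exists_coeff_doubleVars (R := R) γ
  obtain ⟨α, β, rfl⟩ := exists_pair γ
  have hdeg : δ.degree = α.degree + β.degree := by
    rw [← degree_pair, hδ, degree_embDomain]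
  have hle : (∀ i, δ i ≤ 1) ↔ (∀ i, α i ≤ 1) ∧ ∀ i, β i ≤ 1 := by
    rw [← forall_embDomain_equiv Equiv.natSumNatEquivNat.symm δ (· ≤ 1), ← hδ]
    simp [pair_inl, pair_inr]
  have h2 : ∀ q : ℕ × ℕ, coeff (pair α β) (tensorEmb R (e R q.1 ⊗ₜ e R q.2))
      = if (α.degree, β.degree) = q then (if ∀ i, δ i ≤ 1 then 1 else 0) else 0 := by
    intro q
    rw [tensorEmb_tmul, coeff_mul_rename, coe_e, coe_e, coeff_monoSum, coeff_monoSum]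
    by_cases ha : α.degree = q.1 <;> by_cases hb : β.degree = q.2 <;>
      by_cases ha' : ∀ i, α i ≤ 1 <;> by_cases hb' : ∀ i, β i ≤ 1 <;>
      simp [Prod.ext_iff, ha, hb, hle, ha', hb']
  rw [hc, coe_e, coeff_monoSum, map_sum, map_sum, Finset.sum_congr rfl fun q _ => h2 q,
    Finset.sum_ite_eq, hdeg]
  by_cases h3 : α.degree + β.degree = m <;> by_cases h4 : ∀ i, δ i ≤ 1 <;> simp [h3, h4]

theorem comulHom_e (m : ℕ) : comulHom R (e R m)
    = ∑ q ∈ Finset.HasAntidiagonal.antidiagonal m, e R q.1 ⊗ₜ e R q.2 := by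
  apply tensorEmb_injective
  rw [tensorEmb_comulHom, tensorEmb_e]

/-- This is `p_n(x, y) = p_n(x) + p_n(y)`: a power of a single variable involves either an `x` or a
`y`. Positivity of `n` matters, because `p R 0` is the constant `1`, which is not primitive. -/
theorem comulHom_p {n : ℕ} (hn : 0 < n) :
    comulHom R (p R n) = p R n ⊗ₜ 1 + 1 ⊗ₜ p R n := by
  classical
  apply tensorEmb_injective
  rw [tensorEmb_comulHom]
  ext γ
  obtain ⟨δ, hδ, hc⟩ := exists_coeff_doubleVars (R := R) γ
  obtain ⟨α, β, rfl⟩ := exists_pair γ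
  have hp : ∀ α, coeff α (p R n : MvPowerSeries ℕ R)
      = if ∃ i, α = Finsupp.single i n then 1 else 0 := fun α => coeff_monoSum _ _
  have hne : ∀ i : ℕ, Finsupp.single i n ≠ 0 := fun i h => hn.ne' (Finsupp.single_eq_zero.1 h)
  have hiff : (∃ i, δ = Finsupp.single i n) ↔
      ((∃ i, α = Finsupp.single i n) ∧ β = 0) ∨ (α = 0 ∧ ∃ i, β = Finsupp.single i n) := by
    -- Being concentrated in one variable is invariant under relabelling the variables, so the
    -- question moves to `ℕ ⊕ ℕ`, where the variable lies in one of the two summands.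
    have h1 : (∃ i, δ = Finsupp.single i n) ↔ ∃ j, pair α β = Finsupp.single j n := by
      rw [hδ, ← Equiv.natSumNatEquivNat.symm.exists_congr_right]
      refine exists_congr fun i => ?_
      rw [← Equiv.coe_toEmbedding, ← Finsupp.embDomain_single]
      exact (Finsupp.embDomain_injective _).eq_iff.symm
    have hl : ∀ i, Finsupp.single (Sum.inl i) n = pair (Finsupp.single i n) 0 := fun i => by
      simp [pair]
    have hr : ∀ i, Finsupp.single (Sum.inr i) n = pair 0 (Finsupp.single i n) := fun i => by
      simp [pair]
    rw [h1, Sum.exists]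
    refine or_congr ⟨?_, ?_⟩ ⟨?_, ?_⟩
    · rintro ⟨i, h⟩
      rw [hl] at h
      exact ⟨⟨i, (pair_inj h).1⟩, (pair_inj h).2⟩
    · rintro ⟨⟨i, rfl⟩, rfl⟩
      exact ⟨i, (hl i).symm⟩
    · rintro ⟨i, h⟩
      rw [hr] at h
      exact ⟨(pair_inj h).1, i, (pair_inj h).2⟩
    · rintro ⟨rfl, i, rfl⟩
      exact ⟨i, (hr i).symm⟩
  rw [hc, map_add, map_add, tensorEmb_tmul, tensorEmb_tmul, coeff_mul_rename, coeff_mul_rename,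
    hp, hp, hp, Subalgebra.coe_one, MvPowerSeries.coeff_one, MvPowerSeries.coeff_one]
  simp only [hiff]
  by_cases ha : α = 0
  · subst ha
    by_cases hb : ∃ i, β = Finsupp.single i n <;> simp [hb, (hne _).symm]
  · by_cases hb : β = 0 <;> by_cases ha' : ∃ i, α = Finsupp.single i n <;> simp [ha, ha', hb]

theorem coeff_frob_smul {n : ℕ} (hn : 0 < n) (f : Lam R) (β : ℕ →₀ ℕ) :
    coeff (n • β) (frob R n hn f : MvPowerSeries ℕ R) = coeff β (f : MvPowerSeries ℕ R) :=
  MvPowerSeries.coeff_expand_smul n hn.ne' _ _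

theorem coeff_frob_of_not_dvd {n : ℕ} (hn : 0 < n) (f : Lam R) {α : ℕ →₀ ℕ} {i : ℕ}
    (hi : ¬ n ∣ α i) : coeff α (frob R n hn f : MvPowerSeries ℕ R) = 0 :=
  MvPowerSeries.coeff_expand_of_not_dvd n hn.ne' _ hi

theorem eq_smul_or_not_dvd {σ : Type*} (n : ℕ) (α : σ →₀ ℕ) :
    (∃ β : σ →₀ ℕ, α = n • β) ∨ ∃ i, ¬ n ∣ α i := by
  by_cases h : ∀ i, n ∣ α i
  · refine Or.inl ⟨α.mapRange (· / n) (by simp), ?_⟩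
    ext i
    simp [Nat.mul_div_cancel' (h i)]
  · exact Or.inr (not_forall.1 h)

/-- Raising every variable to the `n`-th power commutes with renaming variables. Together with
`tensorEmb_map_frob` it makes `f_n` comultiplicative on all of `Λ`, with no recourse to generators.
-/
theorem doubleVars_frob {n : ℕ} (hn : 0 < n) (f : Lam R) :
    doubleVars R (frob R n hn f) = MvPowerSeries.expand n hn.ne' (doubleVars R f) := by
  ext γ
  obtain ⟨δ, hδ, hc⟩ := exists_coeff_doubleVars (R := R) γ
  rw [hc]
  rcases eq_smul_or_not_dvd n δ with ⟨ε, rfl⟩ | ⟨i, hi⟩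
  · have h1 : γ = n • ε.embDomain Equiv.natSumNatEquivNat.symm.toEmbedding := by
      rw [hδ, Finsupp.embDomain_eq_mapDomain, Finsupp.embDomain_eq_mapDomain,
        Finsupp.mapDomain_smul]
    rw [coeff_frob_smul, h1, MvPowerSeries.coeff_expand_smul]
    exact (MvPowerSeries.coeff_embDomain_rename _ _ ε).symm
  · rw [coeff_frob_of_not_dvd hn f hi, MvPowerSeries.coeff_expand_of_not_dvd
      (i := Equiv.natSumNatEquivNat.symm.toEmbedding i)]
    rwa [hδ, Finsupp.embDomain_apply_self]

theorem tensorEmb_map_frob {n : ℕ} (hn : 0 < n) (t : Lam R ⊗[R] Lam R) :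
    tensorEmb R (Algebra.TensorProduct.map (frob R n hn) (frob R n hn) t)
      = MvPowerSeries.expand n hn.ne' (tensorEmb R t) := by
  induction t using TensorProduct.induction_on with
  | zero => simp
  | add s t hs ht => rw [map_add, map_add, map_add, map_add, hs, ht]
  | tmul u v =>
    rw [Algebra.TensorProduct.map_tmul]
    ext γ
    rcases eq_smul_or_not_dvd n γ with ⟨ε, rfl⟩ | ⟨i, hi⟩
    · obtain ⟨α, β, rfl⟩ := exists_pair ε
      have h1 : n • pair α β = pair (n • α) (n • β) := by
        ext (i | i) <;> simp [pair_inl, pair_inr]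
      rw [MvPowerSeries.coeff_expand_smul, h1, tensorEmb_tmul, tensorEmb_tmul, coeff_mul_rename,
        coeff_mul_rename, coeff_frob_smul, coeff_frob_smul]
    · rw [MvPowerSeries.coeff_expand_of_not_dvd _ _ _ hi]
      obtain ⟨α, β, rfl⟩ := exists_pair γ
      rw [tensorEmb_tmul, coeff_mul_rename]
      rcases i with i | i
      · rw [pair_inl] at hi
        rw [coeff_frob_of_not_dvd hn u hi, zero_mul]
      · rw [pair_inr] at hi
        rw [coeff_frob_of_not_dvd hn v hi, mul_zero]

variable (R) in
/-- The Frobenius endomorphism as a bialgebra homomorphism. -/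
noncomputable def frobBialgHom (n : ℕ) (hn : 0 < n) : Lam R →ₐc[R] Lam R :=
  BialgHom.ofAlgHom (frob R n hn)
    (by
      ext f : 1
      -- The counit is the coefficient at the exponent `0 = n • 0`.
      have h1 := coeff_frob_smul hn f 0
      rwa [smul_zero] at h1)
    (by
      ext f : 1
      apply tensorEmb_injective
      -- Seen in `R[[x, y]]`, both `(f_n ⊗ f_n)(Δ f)` and `Δ(f_n f)` become `f(x^n, y^n)`.
      exact (tensorEmb_map_frob hn _).trans ((congrArg _ (tensorEmb_comulHom f)).trans
        ((doubleVars_frob hn f).symm.trans (tensorEmb_comulHom _).symm)))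

theorem counitHom_e (m : ℕ) : counitHom R (e R m) = if m = 0 then 1 else 0 := by
  classical
  have h1 : counitHom R (e R m) = coeff 0 (e R m : MvPowerSeries ℕ R) := rfl
  rw [h1, coe_e, coeff_monoSum]
  by_cases hm : m = 0
  · simp [hm]
  · simp [hm, Ne.symm hm]

theorem antipodeHom_h_smul (m : ℕ) : antipodeHom R (h R m) = (-1 : R) ^ m • e R m := by
  rw [antipodeHom_h, Algebra.smul_def, map_pow, map_neg, map_one]

variable (R) in
/-- The antipode as a bialgebra homomorphism. -/
noncomputable def antipodeBialgHom : Lam R →ₐc[R] Lam R :=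
  BialgHom.ofAlgHom (antipodeHom R)
    (algHom_ext_h fun m hm => by
      change counitHom R (antipodeHom R (h R m)) = counitHom R (h R m)
      rw [antipodeHom_h, map_mul, counitHom_e, counitHom_h, if_neg hm.ne', mul_zero])
    (algHom_ext_h (A := Lam R ⊗[R] Lam R) fun m _ => by
      change Algebra.TensorProduct.map (antipodeHom R) (antipodeHom R) (comulHom R (h R m))
        = comulHom R (antipodeHom R (h R m))
      -- The signs match termwise: `(-1)^i (-1)^j = (-1)^m` when `i + j = m`.
      rw [antipodeHom_h_smul, comulHom_h, map_sum, map_smul, comulHom_e, Finset.smul_sum]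
      refine Finset.sum_congr rfl fun q hq => ?_
      rw [Algebra.TensorProduct.map_tmul, antipodeHom_h_smul, antipodeHom_h_smul,
        TensorProduct.smul_tmul_smul, ← pow_add, Finset.HasAntidiagonal.mem_antidiagonal.1 hq])

/-- `liftH` ignores the value prescribed at `0`, but the formula persists there because `h_0 = 1`.
Sums over an antidiagonal need this case. -/
theorem versch_h {n : ℕ} (m : ℕ) :
    versch R n (h R m) = if n ∣ m then h R (m / n) else 0 := by
  rcases Nat.eq_zero_or_pos m with rfl | hm
  · rw [h_zero, map_one, if_pos (dvd_zero n), Nat.zero_div, h_zero]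
  · exact liftH_h _ hm

/-- A sum over pairs of multiples of `n` with a given sum. -/
theorem sum_antidiagonal_dvd {M : Type*} [AddCommMonoid M] {n : ℕ} (hn : 0 < n) (m : ℕ)
    (f : ℕ × ℕ → M) (hf : ∀ q, ¬ (n ∣ q.1 ∧ n ∣ q.2) → f q = 0) :
    ∑ q ∈ Finset.HasAntidiagonal.antidiagonal (n * m), f q
      = ∑ q ∈ Finset.HasAntidiagonal.antidiagonal m, f (n * q.1, n * q.2) := by
  symm
  refine Finset.sum_of_injOn (fun q => (n * q.1, n * q.2)) ?_ ?_ ?_ fun _ _ => rfl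
  · rintro ⟨a, b⟩ _ ⟨c, d⟩ _ hq
    simp only [Prod.mk.injEq, mul_right_inj' hn.ne'] at hq
    exact Prod.ext hq.1 hq.2
  · rintro q hq
    simp only [Finset.mem_coe, Finset.HasAntidiagonal.mem_antidiagonal] at hq ⊢
    rw [← mul_add, hq]
  · rintro ⟨a, b⟩ hq hne
    refine hf _ ?_
    rintro ⟨⟨c, rfl⟩, ⟨d, rfl⟩⟩
    rw [Finset.HasAntidiagonal.mem_antidiagonal, ← mul_add, mul_right_inj' hn.ne'] at hq
    exact hne ⟨(c, d), by simpa using hq, rfl⟩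

theorem versch_h_mul {n : ℕ} (hn : 0 < n) (m : ℕ) : versch R n (h R (n * m)) = h R m := by
  rw [versch_h, if_pos (dvd_mul_right n m), Nat.mul_div_cancel_left m hn]

theorem versch_h_of_not_dvd {n m : ℕ} (hm : ¬ n ∣ m) : versch R n (h R m) = 0 := by
  rw [versch_h, if_neg hm]

variable (R) in
/-- The Verschiebung endomorphism as a bialgebra homomorphism. -/
noncomputable def verschBialgHom (n : ℕ) (hn : 0 < n) : Lam R →ₐc[R] Lam R :=
  BialgHom.ofAlgHom (versch R n)
    (algHom_ext_h fun m hm => by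
      change counitHom R (versch R n (h R m)) = counitHom R (h R m)
      by_cases hnm : n ∣ m
      · obtain ⟨l, rfl⟩ := hnm
        rw [versch_h_mul hn, counitHom_h, counitHom_h]
        simp [hn.ne']
      · rw [versch_h_of_not_dvd hnm, map_zero, counitHom_h, if_neg hm.ne'])
    (algHom_ext_h (A := Lam R ⊗[R] Lam R) fun m _ => by
      change Algebra.TensorProduct.map (versch R n) (versch R n) (comulHom R (h R m))
        = comulHom R (versch R n (h R m))
      rw [comulHom_h, map_sum]
      simp only [Algebra.TensorProduct.map_tmul]
      by_cases hnm : n ∣ m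
      · obtain ⟨l, rfl⟩ := hnm
        -- Only pairs with both indices divisible by `n` survive, and dividing them by `n` gives the
        -- pairs with sum `l`.
        rw [versch_h_mul hn, comulHom_h, sum_antidiagonal_dvd hn]
        · simp only [versch_h_mul hn]
        · intro q hq
          rcases not_and_or.1 hq with hq | hq <;> simp [versch_h_of_not_dvd hq]
      · rw [versch_h_of_not_dvd hnm, map_zero]
        refine Finset.sum_eq_zero fun q hq => ?_
        -- If `n` does not divide `m`, it cannot divide both indices of a pair with sum `m`, so
        -- every term has a zero tensor factor.
        by_cases h1 : n ∣ q.1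
        · rw [versch_h_of_not_dvd (m := q.2), TensorProduct.tmul_zero]
          rwa [← Nat.dvd_add_right h1, Finset.HasAntidiagonal.mem_antidiagonal.1 hq]
        · rw [versch_h_of_not_dvd h1, TensorProduct.zero_tmul])

/-- The coproduct of `h_m` is symmetric under the swap, and the `h_m` generate `Λ`. Cocommutativity
is what makes a convolution product of bialgebra homomorphisms comultiplicative. -/
instance : Coalgebra.IsCocomm R (Lam R) where
  comm_comp_comul := by
    have : (Algebra.TensorProduct.comm R (Lam R) (Lam R)).toAlgHom.comp (comulHom R)
        = comulHom R := algHom_ext_h (A := Lam R ⊗[R] Lam R) fun m _ => by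
      rw [AlgHom.comp_apply, comulHom_h, map_sum, ← Finset.Nat.sum_antidiagonal_swap]
      rfl
    exact congrArg AlgHom.toLinearMap this

variable (R) in
/-- The map `U_k` as a bialgebra homomorphism. -/
noncomputable def UBialgHom (k : ℕ) (hk : 0 < k) : Lam R →ₐc[R] Lam R :=
  (frobBialgHom R k hk).comp ((antipodeBialgHom R).comp (verschBialgHom R k hk))

variable (R) in
/-- The map `V_k` as a bialgebra homomorphism. -/
noncomputable def VBialgHom (k : ℕ) (hk : 0 < k) : Lam R →ₐc[R] Lam R :=
  -- This product is taken among bialgebra homomorphisms, where commutativity of `Λ` gives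
  -- multiplicativity and cocommutativity gives comultiplicativity. Its underlying linear map is the
  -- convolution of the underlying maps.
  (WithConv.toConv (BialgHom.id R (Lam R)) * WithConv.toConv (UBialgHom R k hk)).ofConv

theorem UBialgHom_apply {k : ℕ} (hk : 0 < k) (f : Lam R) : UBialgHom R k hk f = U R k hk f := rfl

theorem VBialgHom_apply {k : ℕ} (hk : 0 < k) (f : Lam R) : VBialgHom R k hk f = V R k hk f := rfl

theorem isHopfHom_of_bialgHom {A : Type*} [CommRing A] [HopfAlgebra R A] {f : A →ₗ[R] A}
    (F : A →ₐc[R] A) (hF : ∀ a, F a = f a) : IsHopfHom f :=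
  ⟨⟨F, hF⟩, fun a => by rw [← hF, ← hF, F.apply_antipode]⟩

end HopfMaps

end SymFun

namespace SymFun

/-! ### The values of `V_k` on the complete homogeneous functions -/

section Petrie

variable {R : Type*} [CommRing R]

open MvPowerSeries (coeff)

theorem U_apply {k : ℕ} (hk : 0 < k) (f : Lam R) :
    U R k hk f = frob R k hk (antipodeHom R (versch R k f)) := rfl

theorem V_eq_of_comul {ι : Type*} {k : ℕ} (hk : 0 < k) {f : Lam R} {s : Finset ι}
    {u v : ι → Lam R} (hf : comulHom R f = ∑ i ∈ s, u i ⊗ₜ v i) :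
    V R k hk f = ∑ i ∈ s, u i * U R k hk (v i) := by
  have h1 : V R k hk f = LinearMap.mul' R (Lam R)
      (TensorProduct.map LinearMap.id (U R k hk) (comulHom R f)) := rfl
  rw [h1, hf, map_sum, map_sum]
  rfl

theorem coeff_h (m : ℕ) (α : ℕ →₀ ℕ) :
    coeff α (h R m : MvPowerSeries ℕ R) = if α.degree = m then 1 else 0 := by
  rw [coe_h, coeff_monoSum]
  split_ifs <;> rfl

/-- The sign of an exponent vector all of whose entries are `0` or `k`, and `0` for the other
exponent vectors: the coefficients of `∏ (1 - x_i ^ k)`. -/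
noncomputable def blockSign (R : Type*) [CommRing R] (k : ℕ) (γ : ℕ →₀ ℕ) : R :=
  open Classical in if ∀ i, γ i = 0 ∨ γ i = k then (-1) ^ γ.support.card else 0

/-- For `m = k l` the three maps send `h_m` to `h_l`, then to `(-1)^l e_l`, then to `(-1)^l
e_l(x_0^k, x_1^k, …)`, which is the part of `∏ (1 - x_i^k)` of degree `m`. For other `m` both sides
vanish. -/
theorem coeff_U_h {k : ℕ} (hk : 0 < k) (m : ℕ) (γ : ℕ →₀ ℕ) :
    coeff γ (U R k hk (h R m) : MvPowerSeries ℕ R)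
      = if γ.degree = m then blockSign R k γ else 0 := by
  classical
  rw [U_apply]
  rcases eq_smul_or_not_dvd k γ with ⟨β, rfl⟩ | ⟨i, hi⟩
  · have hdeg : (k • β).degree = k * β.degree := by rw [map_nsmul, smul_eq_mul]
    by_cases hkm : k ∣ m
    · obtain ⟨l, rfl⟩ := hkm
      rw [versch_h_mul hk, coeff_frob_smul, antipodeHom_h_smul, Subalgebra.coe_smul,
        map_smul, coe_e, coeff_monoSum, hdeg, blockSign]
      simp only [mul_right_inj' hk.ne']
      have h1 : (∀ i, (k • β) i = 0 ∨ (k • β) i = k) ↔ ∀ i, β i ≤ 1 := by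
        refine forall_congr' fun i => ?_
        rw [Finsupp.smul_apply, smul_eq_mul, mul_eq_zero, Nat.mul_eq_left hk.ne']
        omega
      rw [Finsupp.support_smul_eq hk.ne']
      by_cases h2 : β.degree = l
      · by_cases h3 : ∀ i, β i ≤ 1
        -- For a squarefree `β` the degree `l` equals the number of variables involved, so the sign
        -- of the antipode is the sign in `blockSign`.
        · rw [if_pos ⟨h2, h3⟩, if_pos h2, if_pos (h1.2 h3), ← degree_eq_card β h3, h2, smul_eq_mul,
            mul_one]
        · rw [if_neg fun h => h3 h.2, if_pos h2, if_neg fun h => h3 (h1.1 h), smul_zero]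
      · rw [if_neg fun h => h2 h.1, if_neg h2, smul_zero]
    · rw [versch_h_of_not_dvd hkm, map_zero, map_zero, if_neg]
      · rfl
      · rintro rfl
        exact hkm (hdeg ▸ dvd_mul_right k _)
  · have h1 : blockSign R k γ = 0 := if_neg fun h => by
      rcases h i with h | h <;> simp [h] at hi
    rw [coeff_frob_of_not_dvd hk _ hi, h1, ite_self]

open Classical in
-- This is the coefficient of `x^α` in `∏ (1 - x_i^k)/(1 - x_i)`. The nonzero terms correspond to
-- the subsets `t` of `{i | k ≤ α i}`, where `c.2` equals `k` on `t` and `0` elsewhere; their signs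
-- cancel unless that set is empty.
theorem sum_blockSign {k : ℕ} (hk : 0 < k) (α : ℕ →₀ ℕ) :
    ∑ c ∈ Finset.HasAntidiagonal.antidiagonal α, blockSign R k c.2
      = if ∀ i, α i < k then 1 else 0 := by
  simp only [blockSign]
  rw [← Finset.sum_filter]
  have hind : ∀ (t : Finset ℕ) (i : ℕ), Finsupp.indicator t (fun _ _ => k) i
      = if i ∈ t then k else 0 := fun t i => by rw [Finsupp.indicator_apply]; split_ifs <;> rfl
  have hsupp : ∀ t : Finset ℕ, (Finsupp.indicator t fun _ _ => k).support = t := fun t => by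
    ext i
    rw [Finsupp.mem_support_iff, hind]
    split_ifs with h <;> simp [h, hk.ne']
  have h3 : ∑ c ∈ Finset.HasAntidiagonal.antidiagonal α with ∀ i, c.2 i = 0 ∨ c.2 i = k,
        (-1 : R) ^ c.2.support.card
      = ∑ t ∈ (α.support.filter fun i => k ≤ α i).powerset, (-1 : R) ^ t.card := by
    refine Finset.sum_bij' (fun c _ => c.2.support)
      (fun t _ => (α - Finsupp.indicator t fun _ _ => k, Finsupp.indicator t fun _ _ => k))
      ?_ ?_ ?_ ?_ fun _ _ => rfl
    · intro c hc
      rw [Finset.mem_filter, Finset.HasAntidiagonal.mem_antidiagonal] at hc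
      rw [Finset.mem_powerset, ← hc.1]
      intro i hi
      rw [Finsupp.mem_support_iff] at hi
      rw [Finset.mem_filter, Finsupp.mem_support_iff, Finsupp.add_apply]
      have := hc.2 i
      omega
    · intro t ht
      rw [Finset.mem_filter, Finset.HasAntidiagonal.mem_antidiagonal]
      refine ⟨tsub_add_cancel_of_le fun i => ?_, fun i => ?_⟩
      · rw [hind]
        split_ifs with hi
        · exact (Finset.mem_filter.1 (Finset.mem_powerset.1 ht hi)).2
        · exact Nat.zero_le _
      · dsimp only
        rw [hind]
        split_ifs <;> simp
    · intro c hc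
      rw [Finset.mem_filter, Finset.HasAntidiagonal.mem_antidiagonal] at hc
      have h6 : (Finsupp.indicator c.2.support fun _ _ => k) = c.2 := by
        ext i
        rw [hind]
        have := hc.2 i
        split_ifs with hi
        · have := Finsupp.mem_support_iff.1 hi
          omega
        · exact (Finsupp.notMem_support_iff.1 hi).symm
      refine Prod.ext ?_ h6
      simp only [h6]
      rw [← hc.1, add_tsub_cancel_right]
    · intro t _
      exact hsupp t
  -- The alternating sum over a powerset is an identity in `ℤ`, transported to `R`.
  have h7 := congrArg (Int.cast : ℤ → R) (Finset.sum_powerset_neg_one_pow_card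
    (x := α.support.filter fun i => k ≤ α i))
  push_cast at h7
  rw [h3, h7]
  refine if_congr ?_ rfl rfl
  rw [Finset.filter_eq_empty_iff]
  refine ⟨fun h i => ?_, fun h i _ => not_le.2 (h i)⟩
  by_cases hi : i ∈ α.support
  · exact not_le.1 (h hi)
  · rwa [Finsupp.notMem_support_iff.1 hi]

/-- A decomposition `α = c.1 + c.2` contributes only to the summand indexed by its pair of degrees,
and that summand occurs exactly when `|α| = m`. After exchanging the sums, `sum_blockSign` applies.
-/
theorem V_h {k : ℕ} (hk : 0 < k) (m : ℕ) : V R k hk (h R m) = G R k m := by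
  classical
  rw [V_eq_of_comul hk (comulHom_h m)]
  apply Subtype.ext
  ext α
  have h1 : ∀ q : ℕ × ℕ, coeff α ((h R q.1 * U R k hk (h R q.2) : Lam R) : MvPowerSeries ℕ R)
      = ∑ c ∈ Finset.HasAntidiagonal.antidiagonal α,
        if (c.1.degree, c.2.degree) = q then blockSign R k c.2 else 0 := by
    intro q
    rw [Subalgebra.coe_mul, MvPowerSeries.coeff_mul]
    refine Finset.sum_congr rfl fun c _ => ?_
    rw [coeff_h, coeff_U_h]
    by_cases ha : c.1.degree = q.1 <;> by_cases hb : c.2.degree = q.2 <;>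
      simp [Prod.ext_iff, ha, hb]
  have h2 : ∀ c ∈ Finset.HasAntidiagonal.antidiagonal α,
      (∑ q ∈ Finset.HasAntidiagonal.antidiagonal m,
        if (c.1.degree, c.2.degree) = q then blockSign R k c.2 else 0)
      = if α.degree = m then blockSign R k c.2 else 0 := by
    intro c hc
    rw [Finset.sum_ite_eq]
    refine if_congr ?_ rfl rfl
    rw [Finset.HasAntidiagonal.mem_antidiagonal,
      ← Finset.HasAntidiagonal.mem_antidiagonal.1 hc, map_add]
  have hG : coeff α (G R k m : MvPowerSeries ℕ R)
      = if α.degree = m ∧ ∀ i, α i < k then 1 else 0 :=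
    (coeff_monoSum _ _).trans (by congr)
  rw [AddSubmonoidClass.coe_finsetSum, map_sum, Finset.sum_congr rfl fun q _ => h1 q,
    Finset.sum_comm, Finset.sum_congr rfl h2, hG]
  by_cases hα : α.degree = m
  · simp only [hα, if_true, true_and, sum_blockSign hk]
  · simp [hα]

end Petrie

/-! ### Newton's identity and the values of `V_k` on the power sums -/

section PowerSums

variable {R : Type*} [CommRing R]

open MvPowerSeries (coeff)

open Classical in
theorem coeff_p (n : ℕ) (α : ℕ →₀ ℕ) : coeff α (p R n : MvPowerSeries ℕ R)
    = if ∃ i, α = Finsupp.single i n then 1 else 0 := coeff_monoSum _ _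

/-- A factorization of `x^α` into a term of `p_n` and a monomial amounts to a choice of `i` with
`x_i^n` dividing `x^α`. As `n > 0`, distinct `i` give distinct factors and all such `i` lie in the
support. -/
theorem coeff_p_mul_h {n : ℕ} (hn : 0 < n) (m : ℕ) (α : ℕ →₀ ℕ) :
    coeff α ((p R n * h R m : Lam R) : MvPowerSeries ℕ R)
      = if α.degree = n + m then ((α.support.filter fun i => n ≤ α i).card : R) else 0 := by
  classical
  have hle : ∀ {i}, n ≤ α i → Finsupp.single i n ≤ α := fun {i} hi => by
    rwa [Finsupp.single_le_iff]
  have h1 : ∀ c ∈ Finset.HasAntidiagonal.antidiagonal α,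
      coeff c.1 (p R n : MvPowerSeries ℕ R) * coeff c.2 (h R m : MvPowerSeries ℕ R)
        = if (∃ i, c.1 = Finsupp.single i n) then (if α.degree = n + m then 1 else 0) else 0 := by
    intro c hc
    rw [coeff_p, coeff_h, ← Finset.HasAntidiagonal.mem_antidiagonal.1 hc, map_add]
    split_ifs with h2 h3 h4 h5
    · simp
    · obtain ⟨i, hi⟩ := h2
      rw [hi, Finsupp.degree_single] at h4
      omega
    · obtain ⟨i, hi⟩ := h2
      rw [hi, Finsupp.degree_single] at h5
      omega
    all_goals simp
  rw [Subalgebra.coe_mul, MvPowerSeries.coeff_mul, Finset.sum_congr rfl h1, ← Finset.sum_filter]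
  rw [Finset.sum_const]
  have h2 : ((Finset.HasAntidiagonal.antidiagonal α).filter
      fun c => ∃ i, c.1 = Finsupp.single i n).card = (α.support.filter fun i => n ≤ α i).card := by
    symm
    refine Finset.card_bij (fun i _ => (Finsupp.single i n, α - Finsupp.single i n)) ?_ ?_ ?_
    · intro i hi
      rw [Finset.mem_filter, Finset.HasAntidiagonal.mem_antidiagonal]
      exact ⟨add_tsub_cancel_of_le (hle (Finset.mem_filter.1 hi).2), i, rfl⟩
    · intro i _ j _ hij
      exact Finsupp.single_left_injective hn.ne' (Prod.ext_iff.1 hij).1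
    · rintro ⟨a, b⟩ hc
      rw [Finset.mem_filter, Finset.HasAntidiagonal.mem_antidiagonal] at hc
      obtain ⟨hab, i, hi⟩ := hc
      dsimp only at hab hi
      subst hi
      have h3 : n ≤ α i := by rw [← hab, Finsupp.add_apply, Finsupp.single_eq_same]; omega
      refine ⟨i, Finset.mem_filter.2 ⟨Finsupp.mem_support_iff.2 (by omega), h3⟩, ?_⟩
      rw [← hab, add_tsub_cancel_left]
  rw [h2]
  split_ifs <;> simp

/-- The power sum `p_n` for `n > 0`, and `0` for `n = 0`. -/
noncomputable def pPos (R : Type*) [CommRing R] (n : ℕ) : Lam R := if n = 0 then 0 else p R n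

theorem pPos_of_pos {n : ℕ} (hn : 0 < n) : pPos R n = p R n := if_neg hn.ne'

/-- Newton's identity `∑ p_i h_{n-i} = n h_n`. -/
theorem sum_p_h (n : ℕ) :
    ∑ q ∈ Finset.HasAntidiagonal.antidiagonal n, pPos R q.1 * h R q.2 = (n : R) • h R n := by
  classical
  apply Subtype.ext
  ext α
  -- The condition `q.1 ≠ 0` reflects the convention `pPos R 0 = 0`; with `p R 0 = 1` there would be
  -- an extra term `h_n`.
  have h1 : ∀ q ∈ Finset.HasAntidiagonal.antidiagonal n,
      coeff α ((pPos R q.1 * h R q.2 : Lam R) : MvPowerSeries ℕ R)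
        = if α.degree = n then
          ((α.support.filter fun i => q.1 ≠ 0 ∧ q.1 ≤ α i).card : R) else 0 := by
    intro q hq
    rw [← Finset.HasAntidiagonal.mem_antidiagonal.1 hq]
    rcases Nat.eq_zero_or_pos q.1 with h2 | h2
    · simp [pPos, h2]
    · rw [pPos_of_pos h2, coeff_p_mul_h h2]
      simp [h2.ne']
  rw [AddSubmonoidClass.coe_finsetSum, map_sum, Finset.sum_congr rfl h1, Subalgebra.coe_smul,
    map_smul, coeff_h]
  split_ifs with hα
  · subst hα
    rw [smul_eq_mul, mul_one, ← Nat.cast_sum,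
      Finset.Nat.sum_antidiagonal_eq_sum_range_succ_mk]
    congr 1
    simp only [Finset.card_filter]
    -- Double counting: the variable `x_i` is counted once for each `j` with `1 ≤ j ≤ α i`, so the
    -- total is the degree of `α`.
    rw [Finset.sum_comm]
    conv_rhs => rw [Finsupp.degree_apply]
    refine Finset.sum_congr rfl fun i hi => ?_
    rw [← Finset.card_filter]
    have h3 : (Finset.range (α.degree + 1)).filter (fun j => j ≠ 0 ∧ j ≤ α i)
        = Finset.Icc 1 (α i) := by
      have := Finsupp.le_degree i α
      ext j
      simp only [Finset.mem_filter, Finset.mem_range, Finset.mem_Icc]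
      omega
    rw [h3, Nat.card_Icc, Nat.add_sub_cancel]
  · simp

/-- Let `P(t)` and `H(t)` be the generating series of `pPos` and `h`, so that `P H = t H'`. Applying
`v_k` to the coefficients turns `H(t)` into `H(t^k)`, and `t d/dt H(t^k) = k P(t^k) H(t^k)`.
Cancelling the unit `H(t^k)` leaves `k P(t^k)`; nothing is divided by an integer, so any `R` is
allowed. -/
theorem versch_pPos {k : ℕ} (hk : 0 < k) (n : ℕ) :
    versch R k (pPos R n) = if k ∣ n then (k : R) • pPos R (n / k) else 0 := by
  let H : PowerSeries (Lam R) := PowerSeries.mk fun n => versch R k (h R n)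
  have hH : IsUnit H := by
    rw [PowerSeries.isUnit_iff_constantCoeff, ← PowerSeries.coeff_zero_eq_constantCoeff_apply,
      PowerSeries.coeff_mk, h_zero, map_one]
    exact isUnit_one
  have h1 : PowerSeries.mk (fun n => versch R k (pPos R n)) * H
      = PowerSeries.mk (fun n => if k ∣ n then (k : R) • pPos R (n / k) else 0) * H := by
    ext1 n
    rw [PowerSeries.coeff_mul, PowerSeries.coeff_mul]
    simp only [H, PowerSeries.coeff_mk]
    simp only [← map_mul]
    rw [← map_sum, sum_p_h, map_smul]
    by_cases hn : k ∣ n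
    · obtain ⟨m, rfl⟩ := hn
      rw [versch_h_mul hk, sum_antidiagonal_dvd hk]
      · simp only [versch_h_mul hk, dvd_mul_right, if_true, Nat.mul_div_cancel_left _ hk,
          smul_mul_assoc]
        -- Newton's identity is used a second time, now in degree `m`: `k (m h_m)` matches the `(k
        -- m) h_m` on the other side.
        rw [← Finset.smul_sum, sum_p_h, smul_smul, Nat.cast_mul]
      · intro q hq
        rcases not_and_or.1 hq with hq | hq
        · rw [if_neg hq, zero_mul]
        · rw [versch_h_of_not_dvd hq, mul_zero]
    · rw [versch_h_of_not_dvd hn, smul_zero]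
      refine (Finset.sum_eq_zero fun q hq => ?_).symm
      by_cases h2 : k ∣ q.1
      · rw [versch_h_of_not_dvd (m := q.2), mul_zero]
        rwa [← Nat.dvd_add_right h2, Finset.HasAntidiagonal.mem_antidiagonal.1 hq]
      · rw [if_neg h2, zero_mul]
  have h2 := congrArg (PowerSeries.coeff n) (hH.mul_right_cancel h1)
  rwa [PowerSeries.coeff_mk, PowerSeries.coeff_mk] at h2

theorem counitHom_p {n : ℕ} (hn : 0 < n) : counitHom R (p R n) = 0 := by
  classical
  have h1 : counitHom R (p R n) = coeff 0 (p R n : MvPowerSeries ℕ R) := rfl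
  rw [h1, coeff_p, if_neg]
  rintro ⟨i, hi⟩
  exact hn.ne' (Finsupp.single_eq_zero.1 hi.symm)

/-- For a primitive element the antipode axiom reads `S(p_n) + p_n = 0`. -/
theorem antipodeHom_p {n : ℕ} (hn : 0 < n) : antipodeHom R (p R n) = - p R n := by
  have h1 : LinearMap.mul' R (Lam R) ((antipodeHom R).toLinearMap.rTensor (Lam R)
      (comulHom R (p R n))) = algebraMap R (Lam R) (counitHom R (p R n)) :=
    HopfAlgebra.mul_antipode_rTensor_comul_apply (p R n)
  rw [comulHom_p hn, counitHom_p hn, map_zero, map_add, map_add] at h1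
  simp only [LinearMap.rTensor_tmul, LinearMap.mul'_apply, AlgHom.toLinearMap_apply, map_one,
    mul_one, one_mul] at h1
  exact eq_neg_of_add_eq_zero_left h1

theorem frob_p {k : ℕ} (hk : 0 < k) (n : ℕ) : frob R k hk (p R n) = p R (k * n) := by
  classical
  apply Subtype.ext
  ext α
  rcases eq_smul_or_not_dvd k α with ⟨β, rfl⟩ | ⟨i, hi⟩
  · rw [coeff_frob_smul, coeff_p, coeff_p]
    refine if_congr (exists_congr fun i => ?_) rfl rfl
    rw [← smul_eq_mul, ← Finsupp.smul_single]
    exact (smul_right_injective _ hk.ne').eq_iff.symm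
  · rw [coeff_frob_of_not_dvd hk _ hi, coeff_p, if_neg]
    rintro ⟨j, rfl⟩
    refine hi ?_
    rw [Finsupp.single_apply]
    split_ifs
    · exact dvd_mul_right k n
    · exact dvd_zero k

/-- For `n = k m` the successive images are `k p_m`, `-k p_m` and `-k p_{k m}`. -/
theorem U_p {k : ℕ} (hk : 0 < k) {n : ℕ} (hn : 0 < n) :
    U R k hk (p R n) = if k ∣ n then -((k : R) • p R n) else 0 := by
  rw [U_apply, ← pPos_of_pos hn, versch_pPos hk]
  split_ifs with hkn
  · obtain ⟨m, rfl⟩ := hkn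
    have hm : 0 < m := Nat.pos_of_mul_pos_left hn
    rw [Nat.mul_div_cancel_left m hk, pPos_of_pos hm, pPos_of_pos hn, map_smul, map_smul,
      antipodeHom_p hm, map_neg, frob_p, smul_neg]
  · rw [map_zero, map_zero]

theorem V_p {k : ℕ} (hk : 0 < k) {n : ℕ} (hn : 0 < n) :
    V R k hk (p R n) = (1 - (if k ∣ n then 1 else 0) * (k : R)) • p R n := by
  -- Writing the two-term coproduct as an indexed sum lets `V_eq_of_comul` apply, giving `p_n U_k(1)
  -- + U_k(p_n)`.
  have h1 : comulHom R (p R n) = ∑ i : Fin 2, ![p R n, 1] i ⊗ₜ ![1, p R n] i := by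
    rw [comulHom_p hn, Fin.sum_univ_two]
    rfl
  have h2 : U R k hk 1 = 1 := by rw [U_apply, map_one, map_one, map_one]
  rw [V_eq_of_comul hk h1, Fin.sum_univ_two]
  simp only [Matrix.cons_val_zero, Matrix.cons_val_one]
  rw [h2, U_p hk hn, sub_smul, one_smul, mul_one, one_mul, sub_eq_add_neg]
  split_ifs <;> simp

end PowerSums

end SymFun

theorem mainTheorem8 (R : Type*) [CommRing R] (k : ℕ) (hk : 0 < k) :
    SymFun.IsHopfHom (SymFun.U R k hk) ∧
    SymFun.IsHopfHom (SymFun.V R k hk) ∧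
    (∀ m : ℕ, SymFun.V R k hk (SymFun.h R m) = SymFun.G R k m) ∧
    (∀ n : ℕ, 0 < n →
      SymFun.V R k hk (SymFun.p R n)
        = (1 - (if k ∣ n then 1 else 0) * (k : R)) • SymFun.p R n) :=
  ⟨SymFun.isHopfHom_of_bialgHom (SymFun.UBialgHom R k hk) (SymFun.UBialgHom_apply hk),
    SymFun.isHopfHom_of_bialgHom (SymFun.VBialgHom R k hk) (SymFun.VBialgHom_apply hk),
    SymFun.V_h hk, fun _ => SymFun.V_p hk⟩
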